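/- Let $\varphi(z)=\sum_{n=1}^{\infty}\frac{1}{2\pi i n^{2}}e^{2\pi i n^{2}z}$ for $\operatorname{Im} z\ge 0$. For a function $f$ on $\mathbb{R}$ with real or complex values and $x\in\mathbb{R}$, the pointwise Hölder exponent of $f$ at $x$ is $$\alpha_f(x)=\sup\{\alpha>0 : f(x+h)=f(x)+O_x(|h|^{\alpha})\ \text{as } h\to 0,\ h\in\mathbb{R}\}.$$ Let $\rho$ be an irrational real number with continued-fraction convergents $r_n=p_n/q_n$, $\gcd(p_n,q_n)=1$, $q_n\ge 1$. For every $n$ with $q_n>1$ (that is, for all but at most two $n$), define $\tau_n$ by $|\rho-r_n|=(1/q_n)^{\tau_n}$. Infinitely many $n$ satisfy $q_n\not\equiv 2\pmod 4$; let $$\tau(\rho)=\limsup_{n\to\infty,\ q_n\not\equiv 2\ (\mathrm{mod}\ 4)}\tau_n,$$ which may be $+\infty$. Then the pointwise Hölder exponent of $\varphi|_{\mathbb{R}}$ at $\rho$ is $$\alpha_{\varphi}(\rho)=\frac12+\frac{1}{2\tau(\rho)},$$ where $1/(2\tau(\rho))=0$ if $\tau(\rho)=\infty$. The same formula holds for the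 pointwise Hölder exponents at $\rho$ of $\operatorname{Re}\varphi|_{\mathbb{R}}$ and $\operatorname{Im}\varphi|_{\mathbb{R}}$. -/

import Mathlib

open Filter Topology Asymptotics

/-- The function `φ(z) = ∑_{n ≥ 1} e(n² z) / (2πi n²)`, where `e(z) = exp (2πi z)`.
The series converges absolutely for `0 ≤ Im z`, in particular for real `z`. -/
noncomputable def riemannPhi (z : ℂ) : ℂ :=
  ∑' n : ℕ+, 1 / (2 * Real.pi * Complex.I * (n : ℂ) ^ 2) *
    Complex.exp (2 * Real.pi * Complex.I * ((n : ℂ) ^ 2 * z))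

/-- The pointwise Hölder exponent of `f` at `x`, i.e. the supremum (in the extended reals) of all
`α > 0` with `f (x + h) = f x + O(|h| ^ α)` as the real increment `h` tends to `0`. -/
noncomputable def pointwiseHolderExponent {E : Type*} [NormedAddCommGroup E]
    (f : ℝ → E) (x : ℝ) : EReal :=
  ⨆ α ∈ {α : ℝ | 0 < α ∧
    (fun h : ℝ => f (x + h) - f x) =O[𝓝 0] (fun h : ℝ => |h| ^ α)}, (α : EReal)

/-- The exponent `τ_n` with `|ρ - p_n / q_n| = (1 / q_n) ^ τ_n`, where `p_n / q_n` is the `n`-th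
convergent of `ρ` in lowest terms (the junk value `0` is used if `q_n = 1`, which happens for at
most two `n` when `ρ` is irrational). -/
noncomputable def convergentExponent (ρ : ℝ) (n : ℕ) : ℝ :=
  Real.logb (1 / ((ρ.convergent n).den : ℝ)) |ρ - (ρ.convergent n : ℝ)|

/-- The defining relation of `τ_n`. -/
theorem abs_sub_convergent_eq {ρ : ℝ} (hρ : Irrational ρ) {n : ℕ}
    (hn : (ρ.convergent n).den ≠ 1) :
    |ρ - (ρ.convergent n : ℝ)| = (1 / ((ρ.convergent n).den : ℝ)) ^ convergentExponent ρ n := by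
  have hpos : (0 : ℝ) < (ρ.convergent n).den := by exact_mod_cast (ρ.convergent n).den_pos
  have hne : ((ρ.convergent n).den : ℝ) ≠ 1 := by exact_mod_cast hn
  refine (Real.rpow_logb (by positivity) (by simpa using hne) ?_).symm
  exact abs_pos.mpr (sub_ne_zero.mpr (hρ.ne_rat _))

/-- `τ(ρ)`, the upper limit (possibly `+∞`) of `τ_n` along the `n` with `q_n ≢ 2 (mod 4)`. -/
noncomputable def convergentTau (ρ : ℝ) : EReal :=
  limsup (fun n : ℕ => (convergentExponent ρ n : EReal))
    (atTop ⊓ 𝓟 {n : ℕ | ¬ (ρ.convergent n).den ≡ 2 [MOD 4]})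

/-! In the upper half plane φ'(z) = (θ(2z) - 1)/2, so the regularity of φ at ρ is governed by the
size of θ near ρ. Splitting θ(2(p/q + w)) into residue classes mod q and applying Jacobi's
functional equation to each gives (-2iq²w)^(-1/2) ∑ₖ Gₖ exp(-πik²/(2q²w)) with quadratic Gauss sums
Gₖ (`hasSum_jacobiTheta_two_mul`). The singular term k = 0 has √q ≤ |G₀| ≤ √(2q), except that G₀ = 0
when q ≡ 2 mod 4; this is why such denominators do not count in τ(ρ).

Lower bound for the exponent: suppose q^(-1/2) ≤ C|ρ - p/q|^β for all reduced p/q with q ≢ 2 mod 4.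
Dirichlet approximation then bounds θ by a multiple of h^β/√y at height y ≤ h and horizontal
distance at most h from ρ. Integrating φ' up, across and down gives increments O(h^(1/2+β))
(`riemannPhi_sub_isBigO_of_forall_rat`). Legendre's theorem supplies the hypothesis with β = 1/(2s)
for every real s > τ(ρ).

Upper bound: integrating the terms k ≠ 0 by parts shows that 2(φ(p/q+h) - φ(p/q)) + h is an explicit
square-root term plus O((q|h|)^(3/2)) (`norm_riemannPhi_near_rat`). For d = |ρ - p/q| ≤ 1/q² and |h|
a small multiple of d, that term dominates, so φ oscillates by at least a multiple of (d/q)^(1/2)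
within 2d of ρ. For convergents with τₙ > s this is at least a multiple of d^(1/2+1/(2s))
(`not_isBigO_of_frequently_rat`). The square-root terms at h and -h differ by a factor ±i, so Re φ
and Im φ obey the same bound. -/

/-! ### Quadratic Gauss sums -/

/-- The quadratic Gauss sum `∑ a mod q, e((p a² + k a) / q)`. -/
noncomputable def quadGaussSum (q : ℕ) [NeZero q] (p k : ZMod q) : ℂ :=
  ∑ a : ZMod q, ZMod.stdAddChar (p * a ^ 2 + k * a)

namespace quadGaussSum

variable {q : ℕ} [NeZero q] {p : ZMod q}

/-- Substituting a = b + c makes the phase difference linear in b with slope 2pc, so orthogonality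
of characters leaves only 2c = 0. -/
theorem mul_conj (hp : IsUnit p) (k : ZMod q) :
    quadGaussSum q p k * starRingEnd ℂ (quadGaussSum q p k) =
      q * ∑ c : ZMod q with 2 * c = 0, ZMod.stdAddChar (p * c ^ 2 + k * c) := by
  have hconj (x : ZMod q) :
      starRingEnd ℂ (ZMod.stdAddChar x : ℂ) = ZMod.stdAddChar (-x) := by
    rw [AddChar.map_neg_eq_conj]
  have h1 : quadGaussSum q p k * starRingEnd ℂ (quadGaussSum q p k) =
      ∑ b : ZMod q, ∑ c : ZMod q, ZMod.stdAddChar (p * c ^ 2 + k * c) *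
        ZMod.stdAddChar (b * (2 * p * c)) := by
    unfold quadGaussSum
    rw [map_sum, Finset.sum_mul_sum, Finset.sum_comm]
    refine Finset.sum_congr rfl fun b _ => ?_
    rw [← Equiv.sum_comp (Equiv.addRight b)]
    refine Finset.sum_congr rfl fun c _ => ?_
    rw [hconj, ← AddChar.map_add_eq_mul, ← AddChar.map_add_eq_mul]
    congr 1
    simp only [Equiv.coe_addRight]
    ring
  rw [h1, Finset.sum_comm, Finset.sum_filter, Finset.mul_sum]
  refine Finset.sum_congr rfl fun c _ => ?_
  rw [← Finset.mul_sum, AddChar.sum_mulShift _ (ZMod.isPrimitive_stdAddChar q)]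
  have : 2 * p * c = 0 ↔ 2 * c = 0 := by
    rw [show 2 * p * c = p * (2 * c) by ring, hp.mul_right_eq_zero]
  simp only [this, ZMod.card]
  split_ifs <;> simp [mul_comm]

theorem val_eq_of_two_mul_eq_zero {c : ZMod q} (hc : 2 * c = 0) : c = 0 ∨ 2 * c.val = q := by
  have h : ((2 * c.val : ℕ) : ZMod q) = 0 := by
    push_cast
    rwa [ZMod.natCast_zmod_val]
  rw [ZMod.natCast_eq_zero_iff] at h
  obtain ⟨m, hm⟩ := h
  have hlt := ZMod.val_lt c
  have hm2 : m < 2 := by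
    by_contra hcon
    have : q * 2 ≤ q * m := Nat.mul_le_mul_left _ (by omega)
    omega
  interval_cases m
  · left
    rw [← ZMod.val_eq_zero]
    omega
  · right; omega

/-- Only c = 0 and c = q/2 can satisfy 2c = 0, and each contributes a number of modulus one. -/
theorem norm_sq_le (hp : IsUnit p) (k : ZMod q) : ‖quadGaussSum q p k‖ ^ 2 ≤ 2 * q := by
  have h := congrArg norm (mul_conj hp k)
  rw [norm_mul, RCLike.norm_conj, ← sq, norm_mul, Complex.norm_natCast] at h
  rw [h, mul_comm]
  gcongr
  refine (norm_sum_le _ _).trans ?_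
  simp only [AddChar.norm_apply, Finset.sum_const, nsmul_eq_mul, mul_one]
  have hsub : (Finset.univ.filter fun c : ZMod q => 2 * c = 0) ⊆ {0, ((q / 2 : ℕ) : ZMod q)} := by
    intro c hc
    rcases val_eq_of_two_mul_eq_zero (Finset.mem_filter.mp hc).2 with h | h
    · simp [h]
    · have : c.val = q / 2 := by omega
      rw [← this, ZMod.natCast_zmod_val]
      simp
  exact_mod_cast (Finset.card_le_card hsub).trans Finset.card_le_two

theorem norm_le (hp : IsUnit p) (k : ZMod q) : ‖quadGaussSum q p k‖ ≤ √(2 * q) :=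
  Real.le_sqrt_of_sq_le (norm_sq_le hp k)

theorem sqrt_le_norm (hp : IsUnit p) (hq : ¬ q ≡ 2 [MOD 4]) :
    √q ≤ ‖quadGaussSum q p 0‖ := by
  refine Real.sqrt_le_iff.mpr ⟨norm_nonneg _, ?_⟩
  have h := congrArg norm (mul_conj hp 0)
  rw [norm_mul, RCLike.norm_conj, ← sq, norm_mul, Complex.norm_natCast] at h
  have h1 : ∑ c : ZMod q with 2 * c = 0, (ZMod.stdAddChar (p * c ^ 2 + 0 * c) : ℂ) =
      ∑ c : ZMod q with 2 * c = 0, 1 := by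
    refine Finset.sum_congr rfl fun c hc => ?_
    -- If c = q/2 occurs then q is even, hence divisible by 4, and (q/2)² = q · (q/4). All terms are
    -- therefore 1 and cannot cancel.
    have hc2 : c ^ 2 = 0 := by
      rcases val_eq_of_two_mul_eq_zero (Finset.mem_filter.mp hc).2 with h | h
      · simp [h]
      · have h4 : q % 4 = 0 := by
          have : q % 4 ≠ 2 := hq
          omega
        rw [← ZMod.natCast_zmod_val c, ← Nat.cast_pow, ZMod.natCast_eq_zero_iff]
        refine ⟨q / 4, ?_⟩
        have h5 : c.val = 2 * (q / 4) := by omega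
        have h6 : q = 4 * (q / 4) := by omega
        rw [h5]
        conv_rhs => rw [h6]
        rw [Nat.mul_div_cancel_left _ (by norm_num)]
        ring
    rw [hc2]
    simp
  rw [h, h1, Finset.sum_const, nsmul_eq_mul, mul_one, Complex.norm_natCast]
  have hcard : 1 ≤ (Finset.univ.filter fun c : ZMod q => 2 * c = 0).card :=
    Finset.card_pos.mpr ⟨0, by simp⟩
  have : (1 : ℝ) ≤ (Finset.univ.filter fun c : ZMod q => 2 * c = 0).card := by exact_mod_cast hcard
  nlinarith [(Nat.cast_nonneg q : (0 : ℝ) ≤ q)]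

/-- For q = 2m with m odd, the shift a ↦ a + m multiplies every term by e(pm²/q) = e(m/q) = -1, as
pm is odd. -/
theorem eq_zero {p : ℤ} (hp : IsCoprime p q) (hq : q ≡ 2 [MOD 4]) :
    quadGaussSum q (p : ZMod q) 0 = 0 := by
  obtain ⟨m, hm, hm2⟩ : ∃ m : ℕ, q = 2 * m ∧ m % 2 = 1 := by
    have : q % 4 = 2 := hq
    exact ⟨q / 2, by omega, by omega⟩
  have hp2 : p % 2 = 1 := by
    have : ¬ (2 : ℤ) ∣ p := fun h2 => by
      have := hp.isUnit_of_dvd' h2 ⟨m, by rw [hm]; push_cast; ring⟩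
      rw [Int.isUnit_iff] at this
      omega
    omega
  have hval : (ZMod.stdAddChar ((p : ZMod q) * (m : ZMod q) ^ 2) : ℂ) = -1 := by
    obtain ⟨t, ht⟩ : ∃ t : ℤ, p * m = 2 * t + 1 := by
      refine ⟨p * m / 2, ?_⟩
      have : (p * m) % 2 = 1 := by
        rw [Int.mul_emod, hp2]
        omega
      omega
    have : (p : ZMod q) * (m : ZMod q) ^ 2 = ((m : ℤ) : ZMod q) := by
      have h1 : ((p * m ^ 2 - m : ℤ) : ZMod q) = 0 := by
        rw [ZMod.intCast_zmod_eq_zero_iff_dvd]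
        refine ⟨t, ?_⟩
        rw [hm, pow_two, ← mul_assoc, ht]
        push_cast
        ring
      push_cast at h1
      rw [sub_eq_zero] at h1
      simpa using h1
    rw [this, ZMod.stdAddChar_coe]
    have hm0 : (m : ℂ) ≠ 0 := by
      have : m ≠ 0 := by omega
      exact_mod_cast this
    rw [← Complex.exp_pi_mul_I]
    congr 1
    rw [hm]
    push_cast
    field_simp
  have h : quadGaussSum q (p : ZMod q) 0 = -quadGaussSum q (p : ZMod q) 0 := by
    conv_lhs => rw [quadGaussSum, ← Equiv.sum_comp (Equiv.addRight (m : ZMod q))]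
    rw [quadGaussSum, ← Finset.sum_neg_distrib]
    refine Finset.sum_congr rfl fun a _ => ?_
    have h2m : (2 : ZMod q) * m = 0 := by
      have : ((2 * m : ℕ) : ZMod q) = 0 := by rw [← hm]; simp
      exact_mod_cast this
    have : (p : ZMod q) * (Equiv.addRight (m : ZMod q) a) ^ 2 + 0 * Equiv.addRight (m : ZMod q) a =
        (p * a ^ 2 + 0 * a) + p * (m : ZMod q) ^ 2 := by
      simp only [Equiv.coe_addRight]
      linear_combination (p : ZMod q) * a * h2m
    rw [this, AddChar.map_add_eq_mul, hval, mul_neg_one]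
  exact self_eq_neg.mp h

end quadGaussSum

/-! ### Transformation of theta at a rational point -/

theorem ZMod.sum_fin_val {M : Type*} [AddCommMonoid M] (q : ℕ) [NeZero q] (g : ℕ → M) :
    ∑ a : Fin q, g a = ∑ x : ZMod q, g x.val := by
  cases q with
  | zero => exact absurd rfl (NeZero.ne 0)
  | succ n => rfl

theorem two_mul_sq_mul_im_pos {q : ℕ} [NeZero q] {w : ℂ} (hw : 0 < w.im) :
    0 < (2 * (q : ℂ) ^ 2 * w).im := by
  have hq : (0 : ℝ) < q := by exact_mod_cast Nat.pos_of_ne_zero (NeZero.ne q)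
  have h : (2 * (q : ℂ) ^ 2 * w) = ((2 * (q : ℝ) ^ 2 : ℝ) : ℂ) * w := by push_cast; ring
  rw [h, Complex.im_ofReal_mul]
  positivity

/-- Splitting the theta series at `2 (p / q + w)` into residue classes modulo `q`. -/
theorem jacobiTheta_two_mul_eq_sum (q : ℕ) [NeZero q] (p : ℤ) {w : ℂ} (hw : 0 < w.im) :
    jacobiTheta (2 * (p / q + w)) =
      ∑ a : ZMod q, ZMod.stdAddChar ((p : ZMod q) * a ^ 2) *
        (Complex.exp (2 * Real.pi * Complex.I * ((a.val : ℂ) ^ 2 * w)) *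
          jacobiTheta₂ (2 * a.val * q * w) (2 * q ^ 2 * w)) := by
  have hq0 : (q : ℂ) ≠ 0 := by exact_mod_cast NeZero.ne q
  have him : 0 < (2 * (p / q + w) : ℂ).im := by
    have h : (2 * (p / q + w) : ℂ) = ((2 * (p / q) : ℝ) : ℂ) + ((2 : ℝ) : ℂ) * w := by
      push_cast; ring
    rw [h, Complex.add_im, Complex.ofReal_im, Complex.im_ofReal_mul]
    linarith
  have hterm (a m : ℤ) : jacobiTheta₂_term (a + m * q) 0 (2 * (p / q + w)) =
      ZMod.stdAddChar ((p : ZMod q) * (a : ZMod q) ^ 2) *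
        (Complex.exp (2 * Real.pi * Complex.I * ((a : ℂ) ^ 2 * w)) *
          jacobiTheta₂_term m (2 * a * q * w) (2 * q ^ 2 * w)) := by
    have h1 : (p : ZMod q) * (a : ZMod q) ^ 2 = ((p * a ^ 2 : ℤ) : ZMod q) := by push_cast; rfl
    rw [h1, ZMod.stdAddChar_coe, jacobiTheta₂_term, jacobiTheta₂_term, ← Complex.exp_add,
      ← Complex.exp_add, Complex.exp_eq_exp_iff_exists_int]
    -- The integer part of p(a + mq)²/q - pa²/q, which the exponential does not see.
    refine ⟨p * (q * m ^ 2 + 2 * a * m), ?_⟩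
    push_cast
    field_simp
    ring
  have hsum : Summable fun n : ℤ => jacobiTheta₂_term n 0 (2 * (p / q + w)) :=
    (summable_jacobiTheta₂_term_iff _ _).mpr him
  have hsum' := (((Int.divModEquiv q).symm.summable_iff.mpr hsum).prod_symm)
  rw [jacobiTheta_eq_jacobiTheta₂, jacobiTheta₂, ← (Int.divModEquiv q).symm.tsum_eq,
    ← (Equiv.prodComm (Fin q) ℤ).tsum_eq]
  refine (Summable.tsum_prod hsum').trans ?_
  have hval := ZMod.sum_fin_val q fun a : ℕ =>
    (ZMod.stdAddChar ((p : ZMod q) * (a : ZMod q) ^ 2) : ℂ) *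
      (Complex.exp (2 * Real.pi * Complex.I * ((a : ℂ) ^ 2 * w)) *
        jacobiTheta₂ (2 * a * q * w) (2 * q ^ 2 * w))
  simp only [ZMod.natCast_zmod_val] at hval
  rw [tsum_fintype, ← hval]
  refine Finset.sum_congr rfl fun a _ => ?_
  rw [jacobiTheta₂, ← tsum_mul_left, ← tsum_mul_left]
  refine tsum_congr fun m => ?_
  have := hterm (a : ℕ) m
  push_cast at this
  rw [← this]
  simp only [Function.comp_apply, Prod.swap_prod_mk, Int.divModEquiv_symm_apply]
  rw [add_comm]

/-- Transformation of the theta series near the rational point `p / q`. -/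
theorem hasSum_jacobiTheta_two_mul (q : ℕ) [NeZero q] (p : ℤ) {w : ℂ} (hw : 0 < w.im) :
    HasSum (fun k : ℤ => 1 / (-Complex.I * (2 * q ^ 2 * w)) ^ (1 / 2 : ℂ) *
      (quadGaussSum q p k *
        Complex.exp (Real.pi * Complex.I * k ^ 2 * (-1 / (2 * q ^ 2 * w)))))
      (jacobiTheta (2 * (p / q + w))) := by
  have hq0 : (q : ℂ) ≠ 0 := by exact_mod_cast NeZero.ne q
  have hw0 : w ≠ 0 := fun h => by simp [h] at hw
  have him : 0 < (-1 / (2 * q ^ 2 * w) : ℂ).im := by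
    have h := two_mul_sq_mul_im_pos (q := q) hw
    rw [neg_div, Complex.neg_im, one_div, Complex.inv_im, neg_div, neg_neg]
    refine div_pos h (Complex.normSq_pos.mpr fun h0 => ?_)
    simp [h0] at h
  have hF (a : ZMod q) : (ZMod.stdAddChar ((p : ZMod q) * a ^ 2) : ℂ) *
        (Complex.exp (2 * Real.pi * Complex.I * ((a.val : ℂ) ^ 2 * w)) *
          jacobiTheta₂ (2 * a.val * q * w) (2 * q ^ 2 * w)) =
      1 / (-Complex.I * (2 * q ^ 2 * w)) ^ (1 / 2 : ℂ) *
        (ZMod.stdAddChar ((p : ZMod q) * a ^ 2) *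
          jacobiTheta₂ (a.val / q) (-1 / (2 * q ^ 2 * w))) := by
    -- The Gaussian factor of the functional equation cancels e(a²w), leaving a prefactor
    -- independent of a.
    rw [jacobiTheta₂_functional_equation]
    have h1 : (2 * a.val * q * w : ℂ) / (2 * q ^ 2 * w) = a.val / q := by
      field_simp
    have h2 : -(Real.pi : ℂ) * Complex.I * (2 * a.val * q * w) ^ 2 / (2 * q ^ 2 * w) =
        -(2 * Real.pi * Complex.I * ((a.val : ℂ) ^ 2 * w)) := by
      field_simp
    rw [h1, h2, Complex.exp_neg]
    have := Complex.exp_ne_zero (2 * Real.pi * Complex.I * ((a.val : ℂ) ^ 2 * w))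
    field_simp
  rw [jacobiTheta_two_mul_eq_sum q p hw, Finset.sum_congr rfl fun a _ => hF a, ← Finset.mul_sum]
  refine HasSum.mul_left _ ?_
  have h := hasSum_sum (s := Finset.univ) fun (a : ZMod q) _ =>
    (hasSum_jacobiTheta₂_term ((a.val : ℂ) / q) him).mul_left
      (ZMod.stdAddChar ((p : ZMod q) * a ^ 2) : ℂ)
  refine h.congr_fun fun k => ?_
  rw [quadGaussSum, Finset.sum_mul]
  refine Finset.sum_congr rfl fun a _ => ?_
  have h3 : (ZMod.stdAddChar ((k : ZMod q) * a) : ℂ) =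
      Complex.exp (2 * Real.pi * Complex.I * k * (a.val / q)) := by
    have : (k : ZMod q) * a = ((k * a.val : ℤ) : ZMod q) := by
      push_cast
      rw [ZMod.natCast_zmod_val]
    rw [this, ZMod.stdAddChar_coe]
    congr 1
    push_cast
    ring
  rw [AddChar.map_add_eq_mul, h3, jacobiTheta₂_term, Complex.exp_add]
  ring

/-! ### φ as a primitive of theta -/

theorem riemannPhi_eq_tsum_nat (z : ℂ) :
    riemannPhi z = ∑' n : ℕ, 1 / (2 * Real.pi * Complex.I * ((n : ℂ) + 1) ^ 2) *
      Complex.exp (Real.pi * Complex.I * ((n : ℂ) + 1) ^ 2 * (2 * z)) := by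
  rw [riemannPhi, tsum_pnat_eq_tsum_succ (f := fun n : ℕ =>
    1 / (2 * Real.pi * Complex.I * (n : ℂ) ^ 2) *
      Complex.exp (2 * Real.pi * Complex.I * ((n : ℂ) ^ 2 * z)))]
  refine tsum_congr fun n => ?_
  push_cast
  ring_nf

theorem norm_exp_pi_mul_I_mul_sq (r : ℝ) (z : ℂ) :
    ‖Complex.exp (Real.pi * Complex.I * (r : ℂ) ^ 2 * z)‖ =
      Real.exp (-(Real.pi * r ^ 2 * z.im)) := by
  have h : (Real.pi * Complex.I * (r : ℂ) ^ 2 * z) = ((Real.pi * r ^ 2 : ℝ) : ℂ) * (Complex.I * z) := by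
    push_cast; ring
  rw [Complex.norm_exp, h, Complex.re_ofReal_mul, Complex.I_mul_re, mul_neg]

theorem norm_exp_pi_mul_I_mul_succ_sq (n : ℕ) (z : ℂ) :
    ‖Complex.exp (Real.pi * Complex.I * ((n : ℂ) + 1) ^ 2 * z)‖ =
      Real.exp (-(Real.pi * ((n : ℝ) + 1) ^ 2 * z.im)) := by
  simpa using norm_exp_pi_mul_I_mul_sq ((n : ℝ) + 1) z

theorem norm_riemannPhi_term_le (n : ℕ) {z : ℂ} (hz : 0 ≤ z.im) :
    ‖1 / (2 * Real.pi * Complex.I * ((n : ℂ) + 1) ^ 2) *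
      Complex.exp (Real.pi * Complex.I * ((n : ℂ) + 1) ^ 2 * (2 * z))‖ ≤
        1 / ((n : ℝ) + 1) ^ 2 := by
  have hn : ‖((n : ℂ) + 1)‖ = (n : ℝ) + 1 := by
    have : ((n : ℂ) + 1) = ((n + 1 : ℝ) : ℂ) := by push_cast; rfl
    rw [this, Complex.norm_real, Real.norm_of_nonneg (by positivity)]
  have h1 : Real.exp (-(Real.pi * ((n : ℝ) + 1) ^ 2 * (2 * z).im)) ≤ 1 := by
    rw [Real.exp_le_one_iff, neg_nonpos]
    have : (2 * z).im = 2 * z.im := by simp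
    rw [this]
    positivity
  rw [norm_mul, norm_exp_pi_mul_I_mul_succ_sq]
  refine (mul_le_of_le_one_right (norm_nonneg _) h1).trans ?_
  rw [norm_div, norm_mul, norm_mul, norm_mul, norm_pow, hn]
  simp only [norm_one, Complex.norm_ofNat, Complex.norm_real, Complex.norm_I, mul_one,
    Real.norm_of_nonneg Real.pi_pos.le]
  have hpi := Real.pi_gt_three
  refine one_div_le_one_div_of_le (by positivity) ?_
  refine le_mul_of_one_le_left (by positivity) (by linarith)

theorem summable_one_div_succ_sq : Summable fun n : ℕ => 1 / ((n : ℝ) + 1) ^ 2 := by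
  have := (summable_nat_add_iff 1).mpr (Real.summable_one_div_nat_pow.mpr one_lt_two)
  simpa using this

theorem continuousOn_riemannPhi : ContinuousOn riemannPhi {z | 0 ≤ z.im} := by
  rw [funext riemannPhi_eq_tsum_nat]
  refine continuousOn_tsum (fun n => ?_) summable_one_div_succ_sq
    fun n z hz => norm_riemannPhi_term_le n hz
  fun_prop

theorem hasDerivAt_riemannPhi {z : ℂ} (hz : 0 < z.im) :
    HasDerivAt riemannPhi ((jacobiTheta (2 * z) - 1) / 2) z := by
  have him (w : ℂ) : (2 * w).im = 2 * w.im := by simp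
  rw [← (hasSum_nat_jacobiTheta (τ := 2 * z) (by rw [him]; linarith)).tsum_eq,
    funext riemannPhi_eq_tsum_nat]
  -- On the half plane Im w > Im z / 2 one has Im 2w > Im z, so the theta terms at i · Im z dominate
  -- the derivatives.
  have hc : 0 < ((z.im : ℂ) * Complex.I).im := by simpa using hz
  have hsum := (hasSum_nat_jacobiTheta hc).summable.norm
  refine hasDerivAt_tsum_of_isPreconnected (t := {w : ℂ | z.im / 2 < w.im})
    (g := fun (n : ℕ) (w : ℂ) => 1 / (2 * Real.pi * Complex.I * ((n : ℂ) + 1) ^ 2) *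
      Complex.exp (Real.pi * Complex.I * ((n : ℂ) + 1) ^ 2 * (2 * w)))
    (g' := fun (n : ℕ) (w : ℂ) => Complex.exp (Real.pi * Complex.I * ((n : ℂ) + 1) ^ 2 * (2 * w)))
    hsum
    (isOpen_lt continuous_const Complex.continuous_im)
    (convex_halfSpace_im_gt _).isPreconnected (fun n y _ => ?_) (fun n y hy => ?_) (y₀ := z) ?_ ?_ ?_
  · have h := ((((hasDerivAt_id (𝕜 := ℂ) y).const_mul 2).const_mul
      (Real.pi * Complex.I * ((n : ℂ) + 1) ^ 2)).cexp).const_mul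
      (1 / (2 * Real.pi * Complex.I * ((n : ℂ) + 1) ^ 2))
    refine h.congr_deriv ?_
    have h1 : ((n : ℂ) + 1) ≠ 0 := by exact_mod_cast Nat.succ_ne_zero n
    have h2 : (Real.pi : ℂ) ≠ 0 := by exact_mod_cast Real.pi_ne_zero
    have h3 := Complex.I_ne_zero
    simp only [id]
    field_simp
  · have hy' : z.im / 2 < y.im := hy
    rw [norm_exp_pi_mul_I_mul_succ_sq, norm_exp_pi_mul_I_mul_succ_sq, Real.exp_le_exp, him,
      Complex.im_ofReal_mul, Complex.I_im, mul_one, neg_le_neg_iff]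
    exact mul_le_mul_of_nonneg_left (by linarith) (by positivity)
  · show z.im / 2 < z.im
    linarith
  · exact summable_one_div_succ_sq.of_norm_bounded fun n => norm_riemannPhi_term_le n hz.le
  · show z.im / 2 < z.im
    linarith

/-- The singularity M/√y is integrable, with integral 2M√H. The derivative exists only for y > 0, so
the path starts at height ε and continuity of φ up to the real line handles ε → 0. -/
theorem norm_riemannPhi_sub_vertical_le {x H M : ℝ} (hH : 0 < H)
    (hM : ∀ y, 0 < y → y ≤ H →
      ‖(jacobiTheta (2 * (x + y * Complex.I)) - 1) / 2‖ ≤ M / √y) :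
    ‖riemannPhi (x + H * Complex.I) - riemannPhi x‖ ≤ 2 * M * √H := by
  have him (y : ℝ) : (x + y * Complex.I : ℂ).im = y := by simp
  have hM0 : 0 ≤ M := by
    have h := (norm_nonneg _).trans (hM H hH le_rfl)
    by_contra hneg
    exact absurd h (not_le.mpr (div_neg_of_neg_of_pos (not_le.mp hneg) (Real.sqrt_pos.mpr hH)))
  have hε : ∀ ε, 0 < ε → ε ≤ H →
      ‖riemannPhi (x + H * Complex.I) - riemannPhi (x + ε * Complex.I)‖ ≤ 2 * M * √H := by
    intro ε hε hεH
    have hder : ∀ y : ℝ, 0 < y → HasDerivAt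
        (fun y : ℝ => riemannPhi (x + y * Complex.I) - riemannPhi (x + ε * Complex.I))
        ((jacobiTheta (2 * (x + y * Complex.I)) - 1) / 2 * Complex.I) y := by
      intro y hy
      have h1 : HasDerivAt (fun y : ℝ => (x + y * Complex.I : ℂ)) Complex.I y := by
        simpa using ((Complex.ofRealCLM.hasDerivAt (x := y)).mul_const Complex.I).const_add (x : ℂ)
      exact ((hasDerivAt_riemannPhi (by rw [him]; exact hy)).comp y h1).sub_const _
    have hB : ∀ y : ℝ, 0 < y → HasDerivAt (fun y => 2 * M * (√y - √ε)) (M / √y) y := by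
      intro y hy
      have h := ((Real.hasDerivAt_sqrt hy.ne').sub_const √ε).const_mul (2 * M)
      exact h.congr_deriv (by have := (Real.sqrt_pos.mpr hy).ne'; field_simp)
    have := image_norm_le_of_norm_deriv_right_le_deriv_boundary'
      (a := ε) (b := H)
      (fun y hy => (hder y (hε.trans_le hy.1)).continuousAt.continuousWithinAt)
      (fun y hy => (hder y (hε.trans_le hy.1)).hasDerivWithinAt)
      (B := fun y => 2 * M * (√y - √ε)) (by simp)
      (fun y hy => (hB y (hε.trans_le hy.1)).continuousAt.continuousWithinAt)
      (fun y hy => (hB y (hε.trans_le hy.1)).hasDerivWithinAt)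
      (fun y hy => by
        rw [norm_mul, Complex.norm_I, mul_one]
        exact hM y (hε.trans_le hy.1) hy.2.le)
      ⟨hεH, le_rfl⟩
    refine this.trans ?_
    gcongr
    linarith [Real.sqrt_nonneg ε]
  have hlim : Tendsto (fun ε : ℝ =>
      ‖riemannPhi (x + H * Complex.I) - riemannPhi (x + ε * Complex.I)‖) (𝓝[>] 0)
      (𝓝 ‖riemannPhi (x + H * Complex.I) - riemannPhi x‖) := by
    refine (tendsto_const_nhds.sub ?_).norm
    have hc := continuousOn_riemannPhi (x : ℂ) (by simp)
    refine Tendsto.comp hc (tendsto_nhdsWithin_iff.mpr ⟨?_, ?_⟩)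
    · have : ContinuousAt (fun ε : ℝ => (x + ε * Complex.I : ℂ)) 0 := by fun_prop
      simpa using this.tendsto.mono_left nhdsWithin_le_nhds
    · filter_upwards [self_mem_nhdsWithin] with ε hε
      show 0 ≤ (x + ε * Complex.I : ℂ).im
      rw [him]
      exact (Set.mem_Ioi.mp hε).le
  refine le_of_tendsto hlim ?_
  filter_upwards [Ioc_mem_nhdsGT hH] with ε hε1
  exact hε ε hε1.1 hε1.2

theorem norm_riemannPhi_sub_horizontal_le {x x' H K : ℝ} (hH : 0 < H)
    (hK : ∀ t ∈ Set.uIcc x x', ‖(jacobiTheta (2 * (t + H * Complex.I)) - 1) / 2‖ ≤ K) :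
    ‖riemannPhi (x' + H * Complex.I) - riemannPhi (x + H * Complex.I)‖ ≤ K * |x' - x| := by
  have him (t : ℝ) : (t + H * Complex.I : ℂ).im = H := by simp
  have hder : ∀ t : ℝ, HasDerivAt (fun t : ℝ => riemannPhi (t + H * Complex.I))
      ((jacobiTheta (2 * (t + H * Complex.I)) - 1) / 2) t := by
    intro t
    have h1 : HasDerivAt (fun t : ℝ => (t + H * Complex.I : ℂ)) 1 t := by
      simpa using (Complex.ofRealCLM.hasDerivAt (x := t)).add_const (H * Complex.I)
    have h := (hasDerivAt_riemannPhi (z := t + H * Complex.I) (by rw [him]; exact hH)).comp t h1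
    rw [mul_one] at h
    exact h
  simpa using Convex.norm_image_sub_le_of_norm_hasDerivWithin_le
    (fun t _ => (hder t).hasDerivWithinAt) hK (convex_uIcc x x') Set.left_mem_uIcc Set.right_mem_uIcc

/-- Go up to height |x' - x|, across, and down: the three legs cost 2, 1 and 2 times M√|x' - x|. -/
theorem norm_riemannPhi_sub_le {x x' M : ℝ} (hx : x' ≠ x)
    (hM : ∀ t ∈ Set.uIcc x x', ∀ y, 0 < y → y ≤ |x' - x| →
      ‖(jacobiTheta (2 * (t + y * Complex.I)) - 1) / 2‖ ≤ M / √y) :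
    ‖riemannPhi x' - riemannPhi x‖ ≤ 5 * M * √|x' - x| := by
  have hH : 0 < |x' - x| := abs_pos.mpr (sub_ne_zero.mpr hx)
  set H := |x' - x| with hHdef
  have h1 := norm_riemannPhi_sub_vertical_le hH (hM x Set.left_mem_uIcc)
  have h2 := norm_riemannPhi_sub_vertical_le hH (hM x' Set.right_mem_uIcc)
  have h3 := norm_riemannPhi_sub_horizontal_le hH fun t ht => hM t ht H hH le_rfl
  rw [← hHdef] at h3
  have h4 : M / √H * H = M * √H := by
    rw [div_mul_eq_mul_div, mul_div_assoc, Real.div_sqrt]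
  rw [h4] at h3
  have h5 : riemannPhi x' - riemannPhi x =
      (riemannPhi (x + H * Complex.I) - riemannPhi x) +
      (riemannPhi (x' + H * Complex.I) - riemannPhi (x + H * Complex.I)) -
      (riemannPhi (x' + H * Complex.I) - riemannPhi x') := by ring
  rw [h5]
  refine (norm_sub_le _ _).trans ?_
  refine (add_le_add (norm_add_le _ _) le_rfl).trans ?_
  linarith

/-! ### Size of theta near a rational point -/

theorem norm_sub_zero_term_le_of_hasSum_int {E : Type*} [NormedAddCommGroup E] [CompleteSpace E]
    {F : ℤ → E} {S : E} (hF : HasSum F S) {b : ℕ → ℝ} (hb : Summable b)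
    (h1 : ∀ n : ℕ, ‖F (n + 1)‖ ≤ b n) (h2 : ∀ n : ℕ, ‖F (-(n + 1))‖ ≤ b n) :
    ‖S - F 0‖ ≤ 2 * ∑' n, b n := by
  have s1 : Summable fun n : ℕ => F (n + 1) := hb.of_norm_bounded h1
  have s2 : Summable fun n : ℕ => F (-(n + 1)) := hb.of_norm_bounded h2
  have s3 : HasSum (fun n : ℕ => F n) (∑' n : ℕ, F (n + 1) + F 0) := by
    have := (hasSum_nat_add_iff (f := fun n : ℕ => F n) 1).mp (by simpa using s1.hasSum)
    simpa using this
  have hS := hF.unique (HasSum.of_nat_of_neg_add_one s3 s2.hasSum)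
  have : S - F 0 = ∑' n : ℕ, F (n + 1) + ∑' n : ℕ, F (-(n + 1)) := by
    rw [hS]; abel
  rw [this, two_mul]
  exact (norm_add_le _ _).trans (add_le_add (tsum_of_norm_bounded hb.hasSum h1)
    (tsum_of_norm_bounded hb.hasSum h2))

theorem summable_exp_neg_pi_mul_succ_sq {T : ℝ} (hT : 0 < T) :
    Summable fun n : ℕ => Real.exp (-(Real.pi * ((n : ℝ) + 1) ^ 2 * T)) := by
  have hc : 0 < ((T : ℂ) * Complex.I).im := by simpa using hT
  have := (hasSum_nat_jacobiTheta hc).summable.norm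
  simp only [norm_exp_pi_mul_I_mul_succ_sq] at this
  simpa using this

/-- The terms decrease, so the sum is at most the Gaussian integral over the positive half line. -/
theorem tsum_exp_neg_pi_mul_succ_sq_le {T : ℝ} (hT : 0 < T) :
    ∑' n : ℕ, Real.exp (-(Real.pi * ((n : ℝ) + 1) ^ 2 * T)) ≤ 1 / (2 * √T) := by
  refine Real.tsum_le_of_sum_range_le (fun n => (Real.exp_pos _).le) fun N => ?_
  have hb : 0 < Real.pi * T := by positivity
  have hanti : AntitoneOn (fun x : ℝ => Real.exp (-(Real.pi * T) * x ^ 2))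
      (Set.Icc 0 (0 + (N : ℝ))) := by
    intro x hx y hy hxy
    refine Real.exp_le_exp.mpr ?_
    have : x ^ 2 ≤ y ^ 2 := pow_le_pow_left₀ hx.1 hxy 2
    nlinarith
  have h1 := hanti.sum_le_integral
  have h2 : ∑ n ∈ Finset.range N, Real.exp (-(Real.pi * ((n : ℝ) + 1) ^ 2 * T)) =
      ∑ i ∈ Finset.range N, Real.exp (-(Real.pi * T) * (0 + ((i + 1 : ℕ) : ℝ)) ^ 2) := by
    refine Finset.sum_congr rfl fun n _ => ?_
    congr 1
    push_cast
    ring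
  rw [h2]
  refine h1.trans ?_
  rw [intervalIntegral.integral_of_le (by simp)]
  have hint : MeasureTheory.IntegrableOn (fun x : ℝ => Real.exp (-(Real.pi * T) * x ^ 2))
      (Set.Ioi 0) := (integrable_exp_neg_mul_sq hb).integrableOn
  refine (MeasureTheory.setIntegral_mono_set hint
    (Filter.Eventually.of_forall fun x => (Real.exp_pos _).le)
    (LE.le.eventuallyLE Set.Ioc_subset_Ioi_self)).trans ?_
  rw [integral_gaussian_Ioi]
  have : √(Real.pi / (Real.pi * T)) = 1 / √T := by
    rw [div_mul_cancel_left₀ Real.pi_ne_zero, Real.sqrt_inv, one_div]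
  rw [this]
  refine le_of_eq ?_
  have := (Real.sqrt_pos.mpr hT).ne'
  field_simp

theorem neg_one_div_im {w : ℂ} (q : ℕ) :
    (-1 / (2 * (q : ℂ) ^ 2 * w)).im = w.im / (2 * q ^ 2 * ‖w‖ ^ 2) := by
  have h : (-1 / (2 * (q : ℂ) ^ 2 * w)) = (((-1 / (2 * q ^ 2) : ℝ)) : ℂ) * w⁻¹ := by
    push_cast
    rw [div_mul_eq_div_div, div_eq_mul_inv (-1 / (2 * (q : ℂ) ^ 2))]
  rw [h, Complex.im_ofReal_mul, Complex.inv_im, Complex.normSq_eq_norm_sq]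
  simp only [div_eq_mul_inv, mul_inv]
  ring

theorem norm_cpow_half (z : ℂ) : ‖z ^ (1 / 2 : ℂ)‖ = √‖z‖ := by
  have : (1 / 2 : ℂ) = ((1 / 2 : ℝ) : ℂ) := by push_cast; rfl
  rw [this, Complex.norm_cpow_real, Real.sqrt_eq_rpow]

/-- The term k = 0 keeps its exact Gauss sum, so that it can vanish; the others use |Gₖ| ≤ √(2q) and
the Gaussian integral bound with T = Im(-1/(2q²w)). -/
theorem norm_jacobiTheta_two_mul_le (q : ℕ) [NeZero q] {p : ℤ} (hp : IsUnit (p : ZMod q))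
    {w : ℂ} (hw : 0 < w.im) :
    ‖jacobiTheta (2 * (p / q + w))‖ ≤
      ‖quadGaussSum q p 0‖ / (q * √(2 * ‖w‖)) + √(2 * q * ‖w‖ / w.im) := by
  have hq : (0 : ℝ) < q := by exact_mod_cast Nat.pos_of_ne_zero (NeZero.ne q)
  have hw0 : 0 < ‖w‖ := norm_pos_iff.mpr fun h => by simp [h] at hw
  set T := w.im / (2 * q ^ 2 * ‖w‖ ^ 2) with hTdef
  have hT : 0 < T := by positivity
  set A : ℝ := 1 / (q * √(2 * ‖w‖)) with hA
  have hA0 : 0 ≤ A := by positivity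
  have hpre : ‖1 / (-Complex.I * (2 * q ^ 2 * w)) ^ (1 / 2 : ℂ)‖ = A := by
    rw [norm_div, norm_one, norm_cpow_half, hA]
    congr 1
    have : ‖-Complex.I * (2 * q ^ 2 * w)‖ = q ^ 2 * (2 * ‖w‖) := by
      simp only [norm_mul, norm_neg, Complex.norm_I, Complex.norm_ofNat, norm_pow,
        Complex.norm_natCast]
      ring
    rw [this, Real.sqrt_mul (by positivity), Real.sqrt_sq hq.le]
  have hterm (k : ℤ) : ‖1 / (-Complex.I * (2 * q ^ 2 * w)) ^ (1 / 2 : ℂ) *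
      (quadGaussSum q p k * Complex.exp (Real.pi * Complex.I * k ^ 2 * (-1 / (2 * q ^ 2 * w))))‖ ≤
      A * √(2 * q) * Real.exp (-(Real.pi * (k : ℝ) ^ 2 * T)) := by
    have := norm_exp_pi_mul_I_mul_sq k (-1 / (2 * (q : ℂ) ^ 2 * w))
    rw [neg_one_div_im, ← hTdef, Complex.ofReal_intCast] at this
    rw [norm_mul, norm_mul, hpre, this, mul_assoc A]
    gcongr
    exact quadGaussSum.norm_le hp _
  have hmain := norm_sub_zero_term_le_of_hasSum_int (hasSum_jacobiTheta_two_mul q p hw)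
    ((summable_exp_neg_pi_mul_succ_sq hT).mul_left (A * √(2 * q)))
    (fun n => by simpa using hterm (n + 1))
    (fun n => by
      have := hterm (-(n + 1))
      have h2 : ((-(n + 1) : ℤ) : ℝ) ^ 2 = ((n : ℝ) + 1) ^ 2 := by push_cast; ring
      rwa [h2] at this)
  rw [tsum_mul_left] at hmain
  have h0 : ‖1 / (-Complex.I * (2 * q ^ 2 * w)) ^ (1 / 2 : ℂ) * (quadGaussSum q p (0 : ℤ) *
      Complex.exp (Real.pi * Complex.I * (0 : ℤ) ^ 2 * (-1 / (2 * q ^ 2 * w))))‖ =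
      ‖quadGaussSum q p 0‖ / (q * √(2 * ‖w‖)) := by
    rw [norm_mul, hpre]
    simp [hA, div_eq_mul_inv, mul_comm]
  have htail : 2 * (A * √(2 * q) * ∑' n : ℕ, Real.exp (-(Real.pi * ((n : ℝ) + 1) ^ 2 * T))) ≤
      √(2 * q * ‖w‖ / w.im) := by
    have := tsum_exp_neg_pi_mul_succ_sq_le hT
    have h3 : 2 * (A * √(2 * q) * (1 / (2 * √T))) = √(2 * q * ‖w‖ / w.im) := by
      have e1 : 2 * (A * √(2 * q) * (1 / (2 * √T))) = √(2 * q) / (q * √(2 * ‖w‖) * √T) := by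
        rw [hA]; field_simp
      have e2 : (q : ℝ) * √(2 * ‖w‖) * √T = √(q ^ 2 * (2 * ‖w‖) * T) := by
        rw [Real.sqrt_mul (show (0 : ℝ) ≤ q ^ 2 * (2 * ‖w‖) by positivity),
          Real.sqrt_mul (show (0 : ℝ) ≤ q ^ 2 by positivity), Real.sqrt_sq hq.le]
      rw [e1, e2, ← Real.sqrt_div (by positivity)]
      congr 1
      rw [hTdef]
      field_simp
    rw [← h3]
    gcongr
  calc _ ≤ _ := norm_le_insert' _ _
    _ ≤ _ := add_le_add h0.le (hmain.trans htail)

/-! ### Lower bound for the Hölder exponent -/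

/-- If the reduced fractions `r` with denominator `≢ 2 mod 4` satisfy
`den⁻¹ᐟ² ≤ C |ρ - r| ^ β`, then the theta function is controlled near `ρ`. -/
theorem norm_jacobiTheta_two_mul_le_of_forall_rat {ρ β C : ℝ} (hβ0 : 0 ≤ β) (hβ : β ≤ 1 / 4)
    (hC0 : 0 ≤ C)
    (hC : ∀ r : ℚ, ¬ r.den ≡ 2 [MOD 4] → 1 / √r.den ≤ C * |ρ - r| ^ β)
    {x y h : ℝ} (hx : |x - ρ| ≤ h) (hy : 0 < y) (hyh : y ≤ h) (hh : h ≤ 1) :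
    ‖jacobiTheta (2 * (x + y * Complex.I))‖ ≤ (2 * C + 2) * h ^ β / √y := by
  have hh0 : 0 < h := hy.trans_le hyh
  have hsy : 0 < √y := Real.sqrt_pos.mpr hy
  have hsy1 : √y ≤ 1 := Real.sqrt_le_one.mpr (hyh.trans hh)
  have hn : 0 < ⌊1 / √y⌋₊ := Nat.floor_pos.mpr ((one_le_div hsy).mpr hsy1)
  -- Dirichlet at scale 1/√y balances both coordinates of w = x + iy - r: |x - r| and y are each at
  -- most √y/q.
  obtain ⟨r, hr1, hr2⟩ := Real.exists_rat_abs_sub_le_and_den_le x hn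
  have : NeZero r.den := ⟨r.den_nz⟩
  have hq : (0 : ℝ) < r.den := by exact_mod_cast r.den_pos
  have hq2 : (r.den : ℝ) ≤ 1 / √y :=
    (Nat.cast_le.mpr hr2).trans (Nat.floor_le (by positivity))
  have hxr : |x - r| ≤ √y / r.den := by
    refine hr1.trans ?_
    have : 1 / √y ≤ (⌊1 / √y⌋₊ : ℝ) + 1 := (Nat.lt_floor_add_one _).le
    rw [div_le_div_iff₀ (by positivity) hq, one_mul]
    have h1 : 1 ≤ √y * ((⌊1 / √y⌋₊ : ℝ) + 1) := by
      rwa [div_le_iff₀' hsy] at this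
    calc (r.den : ℝ) = 1 * r.den := (one_mul _).symm
      _ ≤ √y * ((⌊1 / √y⌋₊ : ℝ) + 1) * r.den := by gcongr
      _ = _ := by ring
  set w : ℂ := ((x - r : ℝ) : ℂ) + y * Complex.I with hw
  have hwim : w.im = y := by simp [hw]
  have hwre : w.re = x - r := by simp [hw]
  have hyw : y ≤ ‖w‖ := by
    have := Complex.abs_im_le_norm w
    rw [hwim] at this
    exact (le_abs_self y).trans this
  have hxw : |x - r| ≤ ‖w‖ := by
    have := Complex.abs_re_le_norm w
    rwa [hwre] at this
  have hw0 : 0 < ‖w‖ := hy.trans_le hyw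
  have hwle : ‖w‖ ≤ 2 * √y / r.den := by
    have h1 := Complex.norm_le_abs_re_add_abs_im w
    rw [hwim, hwre, abs_of_pos hy] at h1
    have h2 : y ≤ √y / r.den := by
      rw [le_div_iff₀ hq]
      calc y * r.den ≤ y * (1 / √y) := by gcongr
        _ = √y := by rw [mul_one_div, Real.div_sqrt]
    calc ‖w‖ ≤ √y / r.den + √y / r.den := h1.trans (add_le_add hxr h2)
      _ = _ := by ring
  have hcop : IsCoprime (r.den : ℤ) r.num := by
    rw [Int.isCoprime_iff_gcd_eq_one, Int.gcd_comm]
    simpa [Int.gcd] using r.reduced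
  have hunit : IsUnit ((r.num : ℤ) : ZMod r.den) :=
    (ZMod.coe_int_isUnit_iff_isCoprime _ _).mpr hcop
  have hpt : (x + y * Complex.I : ℂ) = (r.num : ℂ) / r.den + w := by
    have : ((r : ℝ) : ℂ) = (r.num : ℂ) / r.den := by
      rw [Complex.ofReal_ratCast]; exact Rat.cast_def r
    rw [← this, hw]
    push_cast
    ring
  rw [hpt]
  refine (norm_jacobiTheta_two_mul_le r.den hunit (by rw [hwim]; exact hy)).trans ?_
  have hsec : √(2 * r.den * ‖w‖ / w.im) ≤ 2 * h ^ β / √y := by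
    have e1 : 2 * r.den * ‖w‖ / w.im ≤ 4 / √y := by
      rw [hwim, div_le_div_iff₀ hy hsy]
      have : (r.den : ℝ) * ‖w‖ ≤ 2 * √y := by
        rw [le_div_iff₀ hq] at hwle; linarith
      nlinarith [Real.mul_self_sqrt hy.le]
    -- The nonsingular terms contribute at most 2y^(-1/4); comparing with h^β/√y is what requires β
    -- ≤ 1/4.
    have e2 : √y ≤ (h ^ β) ^ 2 := by
      rw [Real.sqrt_eq_rpow, ← Real.rpow_natCast, ← Real.rpow_mul hh0.le]
      calc y ^ (1 / 2 : ℝ) ≤ h ^ (1 / 2 : ℝ) := by gcongr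
        _ ≤ h ^ (β * (2 : ℕ)) := Real.rpow_le_rpow_of_exponent_ge hh0 hh (by push_cast; linarith)
    refine Real.sqrt_le_iff.mpr ⟨by positivity, e1.trans ?_⟩
    rw [div_pow, mul_pow, div_le_div_iff₀ hsy (by positivity)]
    nlinarith [Real.sq_sqrt hy.le, mul_le_mul_of_nonneg_left e2 hsy.le]
  have hfirst : ‖quadGaussSum r.den (r.num : ZMod r.den) 0‖ / (r.den * √(2 * ‖w‖)) ≤
      2 * C * h ^ β / √y := by
    by_cases hmod : r.den ≡ 2 [MOD 4]
    · rw [quadGaussSum.eq_zero hcop.symm hmod, norm_zero, zero_div]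
      positivity
    · have e1 : ‖quadGaussSum r.den (r.num : ZMod r.den) 0‖ / (r.den * √(2 * ‖w‖)) ≤
          1 / √r.den * (1 / √‖w‖) := by
        calc _ ≤ √(2 * r.den) / (r.den * √(2 * ‖w‖)) := by
              gcongr
              exact quadGaussSum.norm_le hunit _
          _ = _ := by
              rw [Real.sqrt_mul zero_le_two, Real.sqrt_mul zero_le_two]
              have h1 := Real.mul_self_sqrt hq.le
              have h2 := (Real.sqrt_pos.mpr hq).ne'
              have h3 := (Real.sqrt_pos.mpr hw0).ne'
              have h4 : √(2 : ℝ) ≠ 0 := by positivity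
              rw [div_mul_div_comm, div_eq_div_iff (by positivity) (by positivity)]
              linear_combination √2 * √‖w‖ * h1
      have e2 : (|ρ - r|) ^ β * (1 / √‖w‖) ≤ 2 * h ^ β / √y := by
        have hρr : |ρ - r| ≤ h + ‖w‖ := by
          have : |ρ - r| ≤ |x - ρ| + |x - r| := by
            rw [abs_sub_comm x ρ]
            exact abs_sub_le ρ x r
          linarith
        have h2β : (2 : ℝ) ^ β ≤ 2 := by
          calc (2 : ℝ) ^ β ≤ 2 ^ (1 : ℝ) :=
                Real.rpow_le_rpow_of_exponent_le one_le_two (by linarith)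
            _ = 2 := Real.rpow_one 2
        -- Since |ρ - r| ≤ 2 max(h, ‖w‖), either ‖w‖ ≥ y suffices, or the negative exponent β - 1/2
        -- allows ‖w‖ to be replaced by h.
        rcases le_total ‖w‖ h with hwh | hwh
        · calc |ρ - r| ^ β * (1 / √‖w‖) ≤ (2 * h) ^ β * (1 / √y) := by
                gcongr
                linarith
            _ = 2 ^ β * h ^ β * (1 / √y) := by rw [Real.mul_rpow zero_le_two hh0.le]
            _ ≤ 2 * h ^ β * (1 / √y) := by gcongr
            _ = _ := by ring
        · calc |ρ - r| ^ β * (1 / √‖w‖) ≤ (2 * ‖w‖) ^ β * (1 / √‖w‖) := by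
                gcongr
                linarith
            _ = 2 ^ β * (‖w‖ ^ β * (1 / √‖w‖)) := by
                rw [Real.mul_rpow zero_le_two hw0.le]; ring
            _ = 2 ^ β * ‖w‖ ^ (β - 1 / 2) := by
                rw [Real.rpow_sub hw0, Real.sqrt_eq_rpow]; ring
            _ ≤ 2 * h ^ (β - 1 / 2) := by
                exact mul_le_mul h2β (Real.rpow_le_rpow_of_nonpos hh0 hwh (by linarith))
                  (by positivity) zero_le_two
            _ = 2 * h ^ β * (1 / √h) := by
                rw [Real.rpow_sub hh0, Real.sqrt_eq_rpow]; ring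
            _ ≤ 2 * h ^ β * (1 / √y) := by gcongr
            _ = _ := by ring
      calc _ ≤ 1 / √r.den * (1 / √‖w‖) := e1
        _ ≤ C * |ρ - r| ^ β * (1 / √‖w‖) := by
            gcongr
            exact hC r hmod
        _ = C * (|ρ - r| ^ β * (1 / √‖w‖)) := by ring
        _ ≤ C * (2 * h ^ β / √y) := by gcongr
        _ = _ := by ring
  refine (add_le_add hfirst hsec).trans (le_of_eq ?_)
  ring

theorem riemannPhi_sub_isBigO_of_forall_rat {ρ β C : ℝ} (hβ0 : 0 ≤ β) (hβ : β ≤ 1 / 4)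
    (hC0 : 0 ≤ C)
    (hC : ∀ r : ℚ, ¬ r.den ≡ 2 [MOD 4] → 1 / √r.den ≤ C * |ρ - r| ^ β) :
    (fun h : ℝ => riemannPhi ((ρ + h : ℝ) : ℂ) - riemannPhi ρ) =O[𝓝 0]
      fun h : ℝ => |h| ^ (1 / 2 + β) := by
  refine IsBigO.of_bound (5 * (2 * C + 3)) ?_
  filter_upwards [Icc_mem_nhds (show (-1 : ℝ) < 0 by norm_num) (show (0 : ℝ) < 1 by norm_num)]
    with h hh
  have hh1 : |h| ≤ 1 := abs_le.mpr hh
  rw [Real.norm_of_nonneg (by positivity)]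
  rcases eq_or_ne h 0 with rfl | h0
  · simp
    positivity
  have hpos : 0 < |h| := abs_pos.mpr h0
  have hkey := norm_riemannPhi_sub_le (x := ρ) (x' := ρ + h) (M := (2 * C + 3) * |h| ^ β)
    (by simpa using h0) ?_
  · rw [add_sub_cancel_left] at hkey
    refine hkey.trans (le_of_eq ?_)
    rw [Real.rpow_add hpos, ← Real.sqrt_eq_rpow]
    ring
  · intro t ht y hy hyh
    rw [add_sub_cancel_left] at hyh
    have htρ : |t - ρ| ≤ |h| := by
      simpa using Set.abs_sub_left_of_mem_uIcc ht
    have h1 := norm_jacobiTheta_two_mul_le_of_forall_rat hβ0 hβ hC0 hC htρ hy hyh hh1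
    -- Absorbs the 1 in θ - 1, which turns the constant 2C + 2 into 2C + 3.
    have h2 : 1 ≤ |h| ^ β / √y := by
      rw [one_le_div (Real.sqrt_pos.mpr hy)]
      calc √y ≤ √|h| := Real.sqrt_le_sqrt hyh
        _ = |h| ^ (1 / 2 : ℝ) := Real.sqrt_eq_rpow _
        _ ≤ |h| ^ β := Real.rpow_le_rpow_of_exponent_ge hpos hh1 (by linarith)
    rw [norm_div, Complex.norm_ofNat]
    have h3 := norm_sub_le (jacobiTheta (2 * (t + y * Complex.I))) 1
    rw [norm_one] at h3
    have h4 : (2 * C + 3) * |h| ^ β / √y = (2 * C + 2) * |h| ^ β / √y + |h| ^ β / √y := by ring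
    rw [h4]
    have h5 : 0 ≤ (2 * C + 2) * |h| ^ β / √y := by positivity
    linarith

/-! ### Expansion of φ at a rational point -/

/-- The square root `(-2 i q² w) ^ (1/2)` occurring in the transformation of the theta series. -/
noncomputable def thetaRoot (q : ℕ) (w : ℂ) : ℂ := (-Complex.I * (2 * q ^ 2 * w)) ^ (1 / 2 : ℂ)

namespace thetaRoot

variable {q : ℕ} {w : ℂ}

theorem mul_self (q : ℕ) (w : ℂ) :
    thetaRoot q w * thetaRoot q w = -Complex.I * (2 * q ^ 2 * w) := by
  rw [← sq, thetaRoot, ← Complex.cpow_nat_mul]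
  simp

theorem norm_eq (q : ℕ) (w : ℂ) : ‖thetaRoot q w‖ = q * √(2 * ‖w‖) := by
  have hq : (0 : ℝ) ≤ q := Nat.cast_nonneg q
  have : ‖-Complex.I * (2 * q ^ 2 * w)‖ = q ^ 2 * (2 * ‖w‖) := by
    simp only [norm_mul, norm_neg, Complex.norm_I, Complex.norm_ofNat, norm_pow,
      Complex.norm_natCast]
    ring
  rw [thetaRoot, norm_cpow_half, this, Real.sqrt_mul (by positivity), Real.sqrt_sq hq]

theorem ne_zero (hq : q ≠ 0) (hw : w ≠ 0) : thetaRoot q w ≠ 0 := by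
  rw [← norm_pos_iff, norm_eq]
  have : 0 < ‖w‖ := norm_pos_iff.mpr hw
  have : (0 : ℝ) < q := by exact_mod_cast Nat.pos_of_ne_zero hq
  positivity

theorem mem_slitPlane (hq : q ≠ 0) (hw : 0 < w.im) :
    -Complex.I * (2 * q ^ 2 * w) ∈ Complex.slitPlane := by
  left
  have : -Complex.I * (2 * (q : ℂ) ^ 2 * w) = ((2 * q ^ 2 : ℝ) : ℂ) * (-(Complex.I * w)) := by
    push_cast; ring
  rw [this, Complex.re_ofReal_mul, Complex.neg_re, Complex.I_mul_re, neg_neg]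
  have : (0 : ℝ) < q := by exact_mod_cast Nat.pos_of_ne_zero hq
  positivity

theorem hasDerivAt (hq : q ≠ 0) (hw : 0 < w.im) :
    HasDerivAt (thetaRoot q) (-Complex.I * q ^ 2 / thetaRoot q w) w := by
  have hw0 : w ≠ 0 := fun h => by simp [h] at hw
  have hr := ne_zero hq hw0
  have h1 : HasDerivAt (fun w : ℂ => -Complex.I * (2 * q ^ 2 * w)) (-Complex.I * (2 * q ^ 2)) w := by
    simpa using ((hasDerivAt_id w).const_mul (2 * (q : ℂ) ^ 2)).const_mul (-Complex.I)
  refine (h1.cpow_const (c := (1 / 2 : ℂ)) (mem_slitPlane hq hw)).congr_deriv ?_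
  have hne := Complex.slitPlane_ne_zero (mem_slitPlane hq hw)
  rw [Complex.cpow_sub _ _ hne, Complex.cpow_one]
  change 1 / 2 * (thetaRoot q w / _) * _ = _
  rw [← mul_self q w]
  field_simp

/-- For real h ≠ 0 the radicand is purely imaginary and nonzero, hence off the branch cut; this
gives boundary values of the leading term. -/
theorem continuousAt_ofReal (hq : q ≠ 0) {h : ℝ} (hh : h ≠ 0) :
    ContinuousAt (thetaRoot q) (h : ℂ) := by
  have hs : -Complex.I * (2 * q ^ 2 * (h : ℂ)) ∈ Complex.slitPlane := by
    right
    have : -Complex.I * (2 * (q : ℂ) ^ 2 * h) = ((-(2 * q ^ 2 * h) : ℝ) : ℂ) * Complex.I := by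
      push_cast; ring
    rw [this, Complex.im_ofReal_mul, Complex.I_im, mul_one]
    have : (q : ℝ) ≠ 0 := by exact_mod_cast hq
    exact neg_ne_zero.mpr (by positivity)
  have hc : ContinuousAt (fun w : ℂ => -Complex.I * (2 * q ^ 2 * w)) (h : ℂ) := by fun_prop
  exact ContinuousAt.cpow hc continuousAt_const hs

end thetaRoot

theorem integral_horizontal_eq_sub {g g' : ℂ → ℂ} (hg : ∀ w : ℂ, 0 < w.im → HasDerivAt g (g' w) w)
    (hg' : ∀ w : ℂ, 0 < w.im → ContinuousAt g' w) {ε : ℝ} (hε : 0 < ε) (h : ℝ) :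
    ∫ t in (0 : ℝ)..h, g' (t + ε * Complex.I) = g (h + ε * Complex.I) - g (ε * Complex.I) := by
  have him (t : ℝ) : 0 < (t + ε * Complex.I : ℂ).im := by simpa using hε
  have := intervalIntegral.integral_eq_sub_of_hasDerivAt (a := 0) (b := h)
    (f := fun t : ℝ => g (t + ε * Complex.I)) (f' := fun t : ℝ => g' (t + ε * Complex.I))
    (fun t _ => ((hg _ (him t)).comp_add_const (t : ℂ) (ε * Complex.I)).comp_ofReal) ?_
  · simpa using this
  · refine Continuous.intervalIntegrable (continuous_iff_continuousAt.mpr fun t => ?_) _ _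
    exact ContinuousAt.comp (f := fun t : ℝ => (t + ε * Complex.I : ℂ)) (hg' _ (him t)) (by fun_prop)

theorem norm_horizontal_le {t h ε : ℝ} (hε : 0 < ε) (ht : t ∈ Set.uIcc 0 h) :
    ‖(t + ε * Complex.I : ℂ)‖ ≤ |h| + ε := by
  have h1 := Complex.norm_le_abs_re_add_abs_im (t + ε * Complex.I : ℂ)
  have h2 : |t| ≤ |h| := by simpa using Set.abs_sub_left_of_mem_uIcc ht
  simp [abs_of_pos hε] at h1
  linarith

/-- The oscillating terms: integration by parts gains a factor `q² |w| / k²`. -/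
theorem norm_integral_oscillating_le {q : ℕ} (hq : q ≠ 0) {k : ℤ} (hk : k ≠ 0) {ε : ℝ} (hε : 0 < ε)
    (h : ℝ) :
    ‖∫ t in (0 : ℝ)..h, 1 / thetaRoot q (t + ε * Complex.I) *
      Complex.exp (Real.pi * Complex.I * k ^ 2 * (-1 / (2 * q ^ 2 * (t + ε * Complex.I))))‖ ≤
      2 * q * ((|h| + ε) * √(|h| + ε)) / k ^ 2 := by
  have hq0 : (0 : ℝ) < q := by exact_mod_cast Nat.pos_of_ne_zero hq
  have hqc : (q : ℂ) ≠ 0 := by exact_mod_cast hq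
  have hk0 : (0 : ℝ) < (k : ℝ) ^ 2 := by
    have : (k : ℝ) ≠ 0 := by exact_mod_cast hk
    positivity
  have hkc : (k : ℂ) ≠ 0 := by exact_mod_cast hk
  have hpic : (Real.pi : ℂ) ≠ 0 := by exact_mod_cast Real.pi_ne_zero
  set R := |h| + ε with hR
  have hR0 : 0 < R := by positivity
  set E : ℂ → ℂ := fun w => Complex.exp (Real.pi * Complex.I * k ^ 2 * (-1 / (2 * q ^ 2 * w))) with hE
  set B : ℂ := Complex.I * (Real.pi * k ^ 2 / (2 * q ^ 2)) with hB
  have hB0 : B ≠ 0 := mul_ne_zero Complex.I_ne_zero (div_ne_zero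
    (mul_ne_zero hpic (pow_ne_zero 2 hkc)) (mul_ne_zero two_ne_zero (pow_ne_zero 2 hqc)))
  have hw0 {w : ℂ} (hw : 0 < w.im) : w ≠ 0 := fun h => by simp [h] at hw
  have hEder (w : ℂ) (hw : 0 < w.im) : HasDerivAt E (E w * (B / w ^ 2)) w := by
    have h1 : HasDerivAt (fun w : ℂ => Real.pi * Complex.I * k ^ 2 * (-1 / (2 * q ^ 2 * w)))
        (B / w ^ 2) w := by
      have h2 := ((hasDerivAt_inv (hw0 hw)).const_mul
        (-(Real.pi * Complex.I * k ^ 2) / (2 * (q : ℂ) ^ 2)))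
      refine (h2.congr_deriv ?_).congr_of_eventuallyEq (Eventually.of_forall fun z => ?_)
      · rw [hB]; ring
      · simp only [div_eq_mul_inv, mul_inv]; ring
    exact h1.cexp
  have hEnorm (w : ℂ) (hw : 0 < w.im) : ‖E w‖ ≤ 1 := by
    have := norm_exp_pi_mul_I_mul_sq k (-1 / (2 * (q : ℂ) ^ 2 * w))
    rw [neg_one_div_im, Complex.ofReal_intCast] at this
    rw [hE]
    refine this.trans_le (Real.exp_le_one_iff.mpr (neg_nonpos.mpr ?_))
    positivity
  -- Since E' = E · B/w², the integrand is (w²/root) · E'/B. As w²/root is a multiple of w^(3/2),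
  -- its derivative is (3/2) w/root.
  have hder (w : ℂ) (hw : 0 < w.im) : HasDerivAt (fun w => w ^ 2 / thetaRoot q w * E w / B)
      (1 / thetaRoot q w * E w + 3 / 2 * (w / thetaRoot q w) * E w / B) w := by
    have hr0 := thetaRoot.ne_zero hq (hw0 hw)
    have hrr := thetaRoot.mul_self q w
    refine (((((hasDerivAt_pow 2 w).div (thetaRoot.hasDerivAt hq hw) hr0).mul
      (hEder w hw)).div_const B)).congr_deriv ?_
    have h4 : (-Complex.I * q ^ 2 / thetaRoot q w) = thetaRoot q w / (2 * w) := by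
      rw [div_eq_div_iff hr0 (by simpa using hw0 hw), hrr]; ring
    rw [h4]
    have := hw0 hw
    simp only [Nat.cast_ofNat, Nat.add_one_sub_one, pow_one, Pi.div_apply]
    field_simp
    ring
  have hcont1 (w : ℂ) (hw : 0 < w.im) : ContinuousAt (fun w => 1 / thetaRoot q w * E w) w :=
    (continuousAt_const.div (thetaRoot.hasDerivAt hq hw).continuousAt
      (thetaRoot.ne_zero hq (hw0 hw))).mul (hEder w hw).continuousAt
  have hcont2 (w : ℂ) (hw : 0 < w.im) :
      ContinuousAt (fun w => 3 / 2 * (w / thetaRoot q w) * E w / B) w :=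
    ((continuousAt_const.mul (continuousAt_id.div (thetaRoot.hasDerivAt hq hw).continuousAt
      (thetaRoot.ne_zero hq (hw0 hw)))).mul (hEder w hw).continuousAt).div_const B
  have him (t : ℝ) : 0 < (t + ε * Complex.I : ℂ).im := by simpa using hε
  have hint {g : ℂ → ℂ} (hg : ∀ w : ℂ, 0 < w.im → ContinuousAt g w) :
      IntervalIntegrable (fun t : ℝ => g (t + ε * Complex.I)) MeasureTheory.volume 0 h := by
    refine Continuous.intervalIntegrable (continuous_iff_continuousAt.mpr fun t => ?_) _ _
    exact ContinuousAt.comp (f := fun t : ℝ => (t + ε * Complex.I : ℂ)) (hg _ (him t)) (by fun_prop)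
  have hFTC := integral_horizontal_eq_sub hder (fun w hw => (hcont1 w hw).add (hcont2 w hw)) hε h
  rw [intervalIntegral.integral_add (hint hcont1) (hint hcont2)] at hFTC
  have hBn : ‖B‖ = Real.pi * k ^ 2 / (2 * q ^ 2) := by
    rw [hB]
    simp [abs_of_pos Real.pi_pos]
  have hwr (w : ℂ) (hw : w ≠ 0) (hwR : ‖w‖ ≤ R) : ‖w / thetaRoot q w‖ ≤ √R / (√2 * q) := by
    rw [norm_div, thetaRoot.norm_eq, Real.sqrt_mul zero_le_two]
    have h1 : ‖w‖ / (q * (√2 * √‖w‖)) = √‖w‖ / (√2 * q) := by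
      have := Real.mul_self_sqrt (norm_nonneg w)
      have h2 : 0 < √‖w‖ := Real.sqrt_pos.mpr (norm_pos_iff.mpr hw)
      rw [div_eq_div_iff (by positivity) (by positivity)]
      linear_combination -(√2 * q) * this
    rw [h1]
    gcongr
  have hbd (w : ℂ) (hw : 0 < w.im) (hwR : ‖w‖ ≤ R) :
      ‖w ^ 2 / thetaRoot q w * E w / B‖ ≤ R * (√R / (√2 * q)) / ‖B‖ := by
    rw [norm_div, norm_mul, show w ^ 2 / thetaRoot q w = w * (w / thetaRoot q w) by ring, norm_mul]
    have := hwr w (hw0 hw) hwR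
    have := hEnorm w hw
    calc _ ≤ R * (√R / (√2 * q)) * 1 / ‖B‖ := by gcongr
      _ = _ := by rw [mul_one]
  have hbd2 : ‖∫ t in (0 : ℝ)..h, (fun w => 3 / 2 * (w / thetaRoot q w) * E w / B)
      (t + ε * Complex.I)‖ ≤ 3 / 2 * (√R / (√2 * q)) / ‖B‖ * |h - 0| := by
    refine intervalIntegral.norm_integral_le_of_norm_le_const fun t ht => ?_
    have hwR := norm_horizontal_le hε (Set.uIoc_subset_uIcc ht)
    have h1 := hwr _ (hw0 (him t)) hwR
    have h2 := hEnorm _ (him t)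
    simp only
    rw [norm_div, norm_mul, norm_mul]
    have h3 : ‖(3 / 2 : ℂ)‖ = 3 / 2 := by norm_num
    rw [h3]
    calc _ ≤ 3 / 2 * (√R / (√2 * q)) * 1 / ‖B‖ := by gcongr
      _ = _ := by rw [mul_one]
  have hb1 := hbd _ (him h) (norm_horizontal_le hε Set.right_mem_uIcc)
  have hb0 := hbd (ε * Complex.I) (by simpa using hε)
    (by simpa using norm_horizontal_le hε (Set.left_mem_uIcc (a := (0 : ℝ)) (b := h)))
  -- 7/2 = 1 + 1 + 3/2: two endpoint terms and the remaining integral.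
  have hfin : ‖∫ t in (0 : ℝ)..h, (fun w => 1 / thetaRoot q w * E w) (t + ε * Complex.I)‖ ≤
      7 / 2 * (R * (√R / (√2 * q)) / ‖B‖) := by
    rw [eq_sub_of_add_eq hFTC]
    refine (norm_sub_le _ _).trans ((add_le_add ((norm_sub_le _ _).trans
      (add_le_add hb1 hb0)) hbd2).trans ?_)
    have : |h - 0| ≤ R := by rw [sub_zero, hR]; linarith
    have h5 : 3 / 2 * (√R / (√2 * q)) / ‖B‖ * |h - 0| ≤ 3 / 2 * (√R / (√2 * q)) / ‖B‖ * R := by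
      gcongr
    refine (add_le_add le_rfl h5).trans (le_of_eq ?_)
    ring
  refine hfin.trans ?_
  rw [hBn]
  have h6 : 7 / 2 * (R * (√R / (√2 * q)) / (Real.pi * k ^ 2 / (2 * q ^ 2))) =
      7 / (√2 * Real.pi) * (q * (R * √R) / k ^ 2) := by
    field_simp
  have h7 : 7 / (√2 * Real.pi) ≤ 2 := by
    rw [div_le_iff₀ (by positivity)]
    have : 1.4 ≤ √2 := Real.le_sqrt_of_sq_le (by norm_num)
    nlinarith [Real.pi_gt_three]
  rw [h6]
  calc _ ≤ 2 * (q * (R * √R) / k ^ 2) := by gcongr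
    _ = _ := by ring

/-- At fixed height ε > 0 the norm of w lies between ε and |h| + ε, so Im(-1/(2q²w)) is bounded
below and dominated convergence permits termwise integration. -/
theorem hasSum_integral_jacobiTheta (q : ℕ) [NeZero q] {p : ℤ} (hp : IsUnit (p : ZMod q))
    {ε : ℝ} (hε : 0 < ε) (h : ℝ) :
    HasSum (fun k : ℤ => quadGaussSum q p k * ∫ t in (0 : ℝ)..h,
      1 / thetaRoot q (t + ε * Complex.I) *
        Complex.exp (Real.pi * Complex.I * k ^ 2 * (-1 / (2 * q ^ 2 * (t + ε * Complex.I)))))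
      (∫ t in (0 : ℝ)..h, jacobiTheta (2 * (p / q + (t + ε * Complex.I)))) := by
  have hq : q ≠ 0 := NeZero.ne q
  have hq0 : (0 : ℝ) < q := by exact_mod_cast Nat.pos_of_ne_zero hq
  have him (t : ℝ) : (t + ε * Complex.I : ℂ).im = ε := by simp
  have him' (t : ℝ) : 0 < (t + ε * Complex.I : ℂ).im := by rwa [him]
  set T := ε / (2 * q ^ 2 * (|h| + ε) ^ 2) with hT
  have hT0 : 0 < T := by positivity
  have hsum : Summable fun k : ℤ => Real.exp (-(Real.pi * (k : ℝ) ^ 2 * T)) := by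
    have hc : 0 < ((T : ℂ) * Complex.I).im := by simpa using hT0
    have := ((summable_jacobiTheta₂_term_iff 0 _).mpr hc).norm
    simp only [norm_jacobiTheta₂_term] at this
    refine this.congr fun k => ?_
    congr 1
    simp
  simp only [← intervalIntegral.integral_const_mul]
  refine intervalIntegral.hasSum_integral_of_dominated_convergence
    (fun k _ => √(2 * q) * (1 / (q * √(2 * ε)) * Real.exp (-(Real.pi * (k : ℝ) ^ 2 * T))))
    (fun k => ?_) (fun k => ?_) ?_ ?_ ?_
  · refine Continuous.aestronglyMeasurable (continuous_iff_continuousAt.mpr fun t => ?_)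
    have hw0 : (t + ε * Complex.I : ℂ) ≠ 0 := fun h0 => by
      have := him' t
      simp [h0] at this
    have hw1 : (2 * q ^ 2 * (t + ε * Complex.I) : ℂ) ≠ 0 := by
      have : (q : ℂ) ≠ 0 := by exact_mod_cast hq
      exact mul_ne_zero (mul_ne_zero two_ne_zero (pow_ne_zero 2 this)) hw0
    refine continuousAt_const.mul (ContinuousAt.mul (continuousAt_const.div ?_
      (thetaRoot.ne_zero hq hw0)) ?_)
    · exact ContinuousAt.comp (f := fun t : ℝ => (t + ε * Complex.I : ℂ))
        (thetaRoot.hasDerivAt hq (him' t)).continuousAt (by fun_prop)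
    · refine ContinuousAt.cexp (continuousAt_const.mul (continuousAt_const.div ?_ hw1))
      fun_prop
  · refine Eventually.of_forall fun t ht => ?_
    have hwR := norm_horizontal_le hε (Set.uIoc_subset_uIcc ht)
    have hwε : ε ≤ ‖(t + ε * Complex.I : ℂ)‖ := by
      have := Complex.abs_im_le_norm (t + ε * Complex.I : ℂ)
      rw [him] at this
      exact (le_abs_self ε).trans this
    have h2 := norm_exp_pi_mul_I_mul_sq k (-1 / (2 * (q : ℂ) ^ 2 * (t + ε * Complex.I)))
    rw [neg_one_div_im, him, Complex.ofReal_intCast] at h2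
    rw [norm_mul, norm_mul, h2, norm_div, norm_one, thetaRoot.norm_eq]
    have h3 := quadGaussSum.norm_le hp k
    have hpos : 0 < ‖(t + ε * Complex.I : ℂ)‖ := hε.trans_le hwε
    gcongr
    rw [hT]
    gcongr
  · exact Eventually.of_forall fun t _ => (hsum.mul_left _).mul_left _
  · exact intervalIntegrable_const
  · refine Eventually.of_forall fun t _ => ?_
    refine (hasSum_jacobiTheta_two_mul q p (him' t)).congr_fun fun k => ?_
    rw [thetaRoot]
    ring

/-- 2φ(p/q + w) + w is a primitive of θ(2(p/q + w)), and (i/q²) `thetaRoot` is one of the k = 0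
term. The integrated terms k ≠ 0 decay like 1/k². -/
theorem norm_riemannPhi_near_rat_aux (q : ℕ) [NeZero q] {p : ℤ} (hp : IsUnit (p : ZMod q))
    {ε : ℝ} (hε : 0 < ε) (h : ℝ) :
    ‖2 * (riemannPhi (p / q + (h + ε * Complex.I)) - riemannPhi (p / q + ε * Complex.I)) + h -
      quadGaussSum q p 0 * (Complex.I / q ^ 2 *
        (thetaRoot q (h + ε * Complex.I) - thetaRoot q (ε * Complex.I)))‖ ≤
      (4 * √2 * ∑' n : ℕ, 1 / ((n : ℝ) + 1) ^ 2) *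
        (√q * (q * ((|h| + ε) * √(|h| + ε)))) := by
  have hq : q ≠ 0 := NeZero.ne q
  have hqc : (q : ℂ) ≠ 0 := by exact_mod_cast hq
  have him (t : ℝ) : 0 < (t + ε * Complex.I : ℂ).im := by simpa using hε
  have hpq (w : ℂ) : (p / q + w : ℂ).im = w.im := by
    have : (p / q + w : ℂ) = ((p / q : ℝ) : ℂ) + w := by push_cast; rfl
    rw [this, Complex.add_im, Complex.ofReal_im, zero_add]
  have hI1 : ∫ t in (0 : ℝ)..h, jacobiTheta (2 * (p / q + (t + ε * Complex.I))) =
      2 * (riemannPhi (p / q + (h + ε * Complex.I)) - riemannPhi (p / q + ε * Complex.I)) + h := by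
    have := integral_horizontal_eq_sub (g := fun w => 2 * riemannPhi (p / q + w) + w)
      (g' := fun w => jacobiTheta (2 * (p / q + w))) (fun w hw => ?_) (fun w hw => ?_) hε h
    · rw [this]; ring
    · have h1 := (hasDerivAt_riemannPhi (z := p / q + w) (by rwa [hpq])).comp_const_add (p / q : ℂ) w
      refine ((h1.const_mul 2).add (hasDerivAt_id w)).congr_deriv ?_
      ring
    · have h2 : 0 < (2 * (p / q + w) : ℂ).im := by
        rw [show (2 : ℂ) = ((2 : ℝ) : ℂ) by norm_num, Complex.im_ofReal_mul, hpq]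
        linarith
      exact ContinuousAt.comp (f := fun w : ℂ => 2 * (p / q + w)) (continuousAt_jacobiTheta h2)
        (by fun_prop)
  have hI0 : ∫ t in (0 : ℝ)..h, 1 / thetaRoot q (t + ε * Complex.I) =
      Complex.I / q ^ 2 * (thetaRoot q (h + ε * Complex.I) - thetaRoot q (ε * Complex.I)) := by
    have hw0 {w : ℂ} (hw : 0 < w.im) : w ≠ 0 := fun h => by simp [h] at hw
    have := integral_horizontal_eq_sub (g := fun w => Complex.I / q ^ 2 * thetaRoot q w)
      (g' := fun w => 1 / thetaRoot q w) (fun w hw => ?_) (fun w hw => ?_) hε h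
    · rw [this]; ring
    · refine ((thetaRoot.hasDerivAt hq hw).const_mul (Complex.I / (q : ℂ) ^ 2)).congr_deriv ?_
      have := thetaRoot.ne_zero hq (hw0 hw)
      field_simp
      rw [Complex.I_sq]
      ring
    · exact continuousAt_const.div (thetaRoot.hasDerivAt hq hw).continuousAt
        (thetaRoot.ne_zero hq (hw0 hw))
  have hS := hasSum_integral_jacobiTheta q hp hε h
  set R := |h| + ε with hR
  have hterm (k : ℤ) (hk : k ≠ 0) : ‖quadGaussSum q p k * ∫ t in (0 : ℝ)..h,
      1 / thetaRoot q (t + ε * Complex.I) *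
        Complex.exp (Real.pi * Complex.I * k ^ 2 * (-1 / (2 * q ^ 2 * (t + ε * Complex.I))))‖ ≤
      √(2 * q) * (2 * q * (R * √R)) * (1 / (k : ℝ) ^ 2) := by
    rw [norm_mul]
    have h1 := norm_integral_oscillating_le hq hk hε h
    have h2 := quadGaussSum.norm_le hp k
    calc _ ≤ √(2 * q) * (2 * q * (R * √R) / k ^ 2) := by gcongr
      _ = _ := by ring
  have hmain := norm_sub_zero_term_le_of_hasSum_int hS
    (summable_one_div_succ_sq.mul_left (√(2 * q) * (2 * q * (R * √R))))
    (fun n => by simpa using hterm (n + 1) (by omega))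
    (fun n => by
      have := hterm (-(n + 1)) (by omega)
      have h2 : ((-(n + 1) : ℤ) : ℝ) ^ 2 = ((n : ℝ) + 1) ^ 2 := by push_cast; ring
      rwa [h2] at this)
  rw [tsum_mul_left, hI1] at hmain
  have hz : (fun t : ℝ => 1 / thetaRoot q (t + ε * Complex.I) *
      Complex.exp (Real.pi * Complex.I * (0 : ℤ) ^ 2 * (-1 / (2 * q ^ 2 * (t + ε * Complex.I))))) =
      fun t : ℝ => 1 / thetaRoot q (t + ε * Complex.I) := by
    funext t
    simp
  rw [hz, hI0, Int.cast_zero] at hmain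
  refine hmain.trans (le_of_eq ?_)
  rw [Real.sqrt_mul zero_le_two]
  ring

/-- The behaviour of `φ` near the rational number `p / q`. -/
theorem norm_riemannPhi_near_rat (q : ℕ) [NeZero q] {p : ℤ} (hp : IsUnit (p : ZMod q))
    {h : ℝ} (hh : h ≠ 0) :
    ‖2 * (riemannPhi (p / q + h) - riemannPhi (p / q)) + h -
      quadGaussSum q p 0 * (Complex.I / q ^ 2 * thetaRoot q h)‖ ≤
      (4 * √2 * ∑' n : ℕ, 1 / ((n : ℝ) + 1) ^ 2) * (√q * (q * (|h| * √|h|))) := by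
  have hq : q ≠ 0 := NeZero.ne q
  have hφ (a : ℝ) : Tendsto (fun ε : ℝ => riemannPhi (p / q + (a + ε * Complex.I))) (𝓝[>] 0)
      (𝓝 (riemannPhi (p / q + a))) := by
    have hx : (p / q + a : ℂ) = ((p / q + a : ℝ) : ℂ) := by push_cast; rfl
    have hc := continuousOn_riemannPhi (p / q + a : ℂ) (by rw [hx]; simp)
    refine Tendsto.comp hc (tendsto_nhdsWithin_iff.mpr ⟨?_, ?_⟩)
    · have : ContinuousAt (fun ε : ℝ => (p / q + (a + ε * Complex.I) : ℂ)) 0 := by fun_prop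
      simpa using this.tendsto.mono_left nhdsWithin_le_nhds
    · filter_upwards [self_mem_nhdsWithin] with ε hε
      show 0 ≤ (p / q + (a + ε * Complex.I) : ℂ).im
      rw [← add_assoc, hx, Complex.add_im, Complex.ofReal_im]
      simpa using (Set.mem_Ioi.mp hε).le
  have hφ0 := hφ 0
  simp only [Complex.ofReal_zero, zero_add, add_zero] at hφ0
  have hr : Tendsto (fun ε : ℝ => thetaRoot q (h + ε * Complex.I)) (𝓝[>] 0)
      (𝓝 (thetaRoot q h)) := by
    have hc := thetaRoot.continuousAt_ofReal hq hh
    refine Tendsto.comp hc ?_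
    have : ContinuousAt (fun ε : ℝ => (h + ε * Complex.I : ℂ)) 0 := by fun_prop
    simpa using this.tendsto.mono_left nhdsWithin_le_nhds
  -- The branch point 0 is outside the slit plane, so the limit is read off from the norm.
  have hr0 : Tendsto (fun ε : ℝ => thetaRoot q (ε * Complex.I)) (𝓝[>] 0) (𝓝 0) := by
    rw [tendsto_zero_iff_norm_tendsto_zero]
    simp only [thetaRoot.norm_eq]
    have : ContinuousAt (fun ε : ℝ => (q : ℝ) * √(2 * ‖(ε * Complex.I : ℂ)‖)) 0 := by fun_prop
    simpa using this.tendsto.mono_left nhdsWithin_le_nhds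
  have hR : Tendsto (fun ε : ℝ => (4 * √2 * ∑' n : ℕ, 1 / ((n : ℝ) + 1) ^ 2) *
      (√q * (q * ((|h| + ε) * √(|h| + ε))))) (𝓝[>] 0)
      (𝓝 ((4 * √2 * ∑' n : ℕ, 1 / ((n : ℝ) + 1) ^ 2) * (√q * (q * (|h| * √|h|))))) := by
    have : ContinuousAt (fun ε : ℝ => (4 * √2 * ∑' n : ℕ, 1 / ((n : ℝ) + 1) ^ 2) *
      (√q * (q * ((|h| + ε) * √(|h| + ε))))) 0 := by fun_prop
    simpa only [add_zero] using this.tendsto.mono_left nhdsWithin_le_nhds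
  have hL := (((((hφ h).sub hφ0).const_mul 2).add_const (h : ℂ)).sub
    (((hr.sub hr0).const_mul (Complex.I / (q : ℂ) ^ 2)).const_mul (quadGaussSum q p 0))).norm
  rw [sub_zero] at hL
  refine le_of_tendsto_of_tendsto hL hR ?_
  filter_upwards [self_mem_nhdsWithin] with ε hε
  exact norm_riemannPhi_near_rat_aux q hp hε h

/-! ### Upper bound for the Hölder exponent -/

theorem Rat.isUnit_num_zmod_den (r : ℚ) : IsUnit ((r.num : ℤ) : ZMod r.den) := by
  rw [ZMod.coe_int_isUnit_iff_isCoprime, Int.isCoprime_iff_gcd_eq_one, Int.gcd_comm]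
  simpa [Int.gcd] using r.reduced

/-- In at least one of the two directions, the leading term of `φ` at a rational number whose
denominator is `≢ 2 mod 4` has a large component in a prescribed direction. -/
theorem exists_le_abs_re_leading_term (q : ℕ) [NeZero q] {p : ℤ} (hp : IsUnit (p : ZMod q))
    (hq4 : ¬ q ≡ 2 [MOD 4]) {u : ℂ} (hu : ‖u‖ = 1) {s : ℝ} (hs : 0 < s) :
    ∃ h : ℝ, |h| = s ∧ √s / √q ≤
      |(u * (quadGaussSum q p 0 * (Complex.I / q ^ 2 * thetaRoot q h))).re| := by
  have hq : q ≠ 0 := NeZero.ne q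
  have hq0 : (0 : ℝ) < q := by exact_mod_cast Nat.pos_of_ne_zero hq
  set A : ℂ := u * (quadGaussSum q p 0 * (Complex.I / q ^ 2)) with hA
  have hAr (h : ℝ) : u * (quadGaussSum q p 0 * (Complex.I / q ^ 2 * thetaRoot q h)) =
      A * thetaRoot q h := by rw [hA]; ring
  simp only [hAr]
  set M := A * thetaRoot q s with hM
  have hMn : √2 * (√s / √q) ≤ ‖M‖ := by
    have h1 : ‖M‖ = ‖quadGaussSum q p 0‖ * (√2 * √s / q) := by
      rw [hM, hA]
      simp only [norm_mul, norm_div, norm_pow, Complex.norm_I, Complex.norm_natCast, hu,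
        thetaRoot.norm_eq, Complex.norm_real, Real.norm_of_nonneg hs.le]
      rw [Real.sqrt_mul zero_le_two]
      field_simp
    rw [h1]
    calc √2 * (√s / √q) = √q * (√2 * √s / q) := by
          have h2 := Real.mul_self_sqrt hq0.le
          have h3 := (Real.sqrt_pos.mpr hq0).ne'
          field_simp
          linear_combination -h2
      _ ≤ _ := by
          gcongr
          exact quadGaussSum.sqrt_le_norm hp hq4
  -- The squares at s and -s are opposite, so the roots differ by ±i and the real part at -s is, up
  -- to sign, the imaginary part at s. The larger of the two is at least ‖M‖/√2.
  have hneg : A * thetaRoot q (-s : ℝ) = Complex.I * M ∨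
      A * thetaRoot q (-s : ℝ) = -(Complex.I * M) := by
    refine sq_eq_sq_iff_eq_or_eq_neg.mp ?_
    have e1 := thetaRoot.mul_self q (s : ℂ)
    have e2 := thetaRoot.mul_self q ((-s : ℝ) : ℂ)
    push_cast at e2 ⊢
    rw [hM]
    linear_combination A ^ 2 * e2 + A ^ 2 * e1 - A ^ 2 * thetaRoot q s ^ 2 * Complex.I_sq
  have hnegre : |(A * thetaRoot q (-s : ℝ)).re| = |M.im| := by
    rcases hneg with h | h <;> rw [h] <;> simp
  have hsq : (√s / √q) ^ 2 * 2 ≤ M.re ^ 2 + M.im ^ 2 := by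
    have h1 : M.re ^ 2 + M.im ^ 2 = ‖M‖ ^ 2 := by
      rw [← Complex.normSq_eq_norm_sq, Complex.normSq_apply]; ring
    rw [h1]
    calc _ = (√2 * (√s / √q)) ^ 2 := by rw [mul_pow, Real.sq_sqrt zero_le_two]; ring
      _ ≤ _ := by gcongr
  rcases le_total (M.im ^ 2) (M.re ^ 2) with h | h
  · refine ⟨s, abs_of_pos hs, ?_⟩
    exact (le_abs_self _).trans (sq_le_sq.mp (by linarith))
  · refine ⟨-s, by rw [abs_neg, abs_of_pos hs], ?_⟩
    rw [hnegre]
    exact (le_abs_self _).trans (sq_le_sq.mp (by linarith))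

/-- Points near which the leading term dominates obstruct Hölder regularity. -/
theorem not_isBigO_of_frequently_rat {ρ β α : ℝ} (hβ : 0 ≤ β) (hα : 1 / 2 + β < α)
    (hr : ∀ δ > 0, ∃ r : ℚ, ¬ r.den ≡ 2 [MOD 4] ∧ 0 < |ρ - r| ∧ |ρ - r| < δ ∧
      |ρ - r| ≤ 1 / (r.den : ℝ) ^ 2 ∧ |ρ - r| ^ β ≤ 1 / √r.den)
    {u : ℂ} (hu : ‖u‖ = 1) :
    ¬ (fun h : ℝ => (u * (riemannPhi ((ρ + h : ℝ) : ℂ) - riemannPhi ρ)).re) =O[𝓝 0]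
      fun h : ℝ => |h| ^ α := by
  intro hO
  obtain ⟨K, hK0, hK⟩ := hO.exists_pos
  rw [IsBigOWith, Metric.eventually_nhds_iff] at hK
  obtain ⟨δ, hδ, hK⟩ := hK
  have hα0 : 0 < α := by linarith
  have hK' (x : ℝ) (hx : |x - ρ| < δ) :
      |(u * (riemannPhi x - riemannPhi ρ)).re| ≤ K * |x - ρ| ^ α := by
    have := hK (y := x - ρ) (by simpa using hx)
    rwa [add_sub_cancel, Real.norm_eq_abs, Real.norm_of_nonneg (by positivity)] at this
  set C := 4 * √2 * ∑' n : ℕ, 1 / ((n : ℝ) + 1) ^ 2 with hC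
  have hC0 : 0 ≤ C := by
    have : 0 ≤ ∑' n : ℕ, 1 / ((n : ℝ) + 1) ^ 2 := tsum_nonneg fun n => by positivity
    positivity
  -- With |h| = c²d, the linear term and the error are at most c and Cc times √s/√q, together half
  -- of the leading term's lower bound.
  set c := 1 / (2 * (1 + C)) with hc
  have hc0 : 0 < c := by positivity
  have hc1 : c ≤ 1 := by
    rw [hc, div_le_one (by positivity)]; linarith
  have hcC : c * (1 + C) = 1 / 2 := by rw [hc]; field_simp
  have hlim : Tendsto (fun d : ℝ => 4 * (K * (2 ^ α + 1)) * d ^ (α - 1 / 2 - β)) (𝓝 0) (𝓝 0) := by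
    have h1 : Tendsto (fun d : ℝ => d ^ (α - 1 / 2 - β)) (𝓝 0) (𝓝 (0 ^ (α - 1 / 2 - β))) :=
      (Real.continuousAt_rpow_const _ _ (Or.inr (by linarith))).tendsto
    rw [Real.zero_rpow (by linarith)] at h1
    simpa using h1.const_mul (4 * (K * (2 ^ α + 1)))
  obtain ⟨δ', hδ', hsmall⟩ := Metric.eventually_nhds_iff.mp (hlim.eventually_lt_const hc0)
  obtain ⟨r, hr4, hd0, hdδ, hdq, hdβ⟩ := hr (min (δ / 2) δ') (by positivity)
  set d := |ρ - r| with hd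
  have hcontra := hsmall (y := d) (by
    rw [Real.dist_eq, sub_zero, abs_of_pos hd0]; exact hdδ.trans_le (min_le_right _ _))
  have hdδ2 : d < δ / 2 := hdδ.trans_le (min_le_left _ _)
  have : NeZero r.den := ⟨r.den_nz⟩
  have hq : (0 : ℝ) < r.den := by exact_mod_cast r.den_pos
  have hq1 : (1 : ℝ) ≤ r.den := by exact_mod_cast r.den_pos
  set s := c ^ 2 * d with hs
  have hs0 : 0 < s := by positivity
  have hsd : s ≤ d := by
    rw [hs]; exact mul_le_of_le_one_left hd0.le (pow_le_one₀ hc0.le hc1)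
  have hunit := r.isUnit_num_zmod_den
  obtain ⟨h, hhs, hlead⟩ := exists_le_abs_re_leading_term r.den hunit hr4 hu hs0
  have hh0 : h ≠ 0 := fun h0 => by rw [h0, abs_zero] at hhs; exact hs0.ne hhs
  have hnear := norm_riemannPhi_near_rat r.den hunit hh0
  rw [hhs, ← hC] at hnear
  have hrc : ((r.num : ℂ) / r.den) = ((r : ℝ) : ℂ) := by
    rw [Complex.ofReal_ratCast]; exact (Rat.cast_def r).symm
  rw [hrc] at hnear
  have hsqrts : √s = c * √d := by
    rw [hs, Real.sqrt_mul (by positivity), Real.sqrt_sq hc0.le]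
  have hsq : √s * √r.den ≤ c := by
    have h1 : √d ≤ 1 / r.den := by
      refine Real.sqrt_le_iff.mpr ⟨by positivity, hdq.trans (le_of_eq ?_)⟩
      rw [div_pow, one_pow]
    have h2 : √(r.den : ℝ) ≤ r.den := Real.sqrt_le_self_iff.mpr (Or.inr hq1)
    calc √s * √r.den ≤ c * (1 / r.den) * r.den := by rw [hsqrts]; gcongr
      _ = c := by field_simp
  have hb1 : s ≤ c * (√s / √r.den) := by
    have h1 := Real.mul_self_sqrt hs0.le
    have h2 : 0 < √(r.den : ℝ) := Real.sqrt_pos.mpr hq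
    rw [mul_div_assoc', le_div_iff₀ h2]
    calc s * √r.den = √s * √r.den * √s := by rw [← h1, Real.sqrt_mul_self (Real.sqrt_nonneg s)]; ring
      _ ≤ c * √s := by gcongr
  have hb2 : √r.den * (r.den * (s * √s)) ≤ c * (√s / √r.den) := by
    have h2 : 0 < √(r.den : ℝ) := Real.sqrt_pos.mpr hq
    have h3 := Real.mul_self_sqrt hq.le
    have h4 : s * (r.den : ℝ) ^ 2 ≤ c := by
      have : d * (r.den : ℝ) ^ 2 ≤ 1 := by rwa [le_div_iff₀ (by positivity)] at hdq
      calc s * (r.den : ℝ) ^ 2 = c ^ 2 * (d * (r.den : ℝ) ^ 2) := by rw [hs]; ring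
        _ ≤ c ^ 2 * 1 := by gcongr
        _ ≤ c := by nlinarith
    rw [mul_div_assoc', le_div_iff₀ h2]
    calc √r.den * (r.den * (s * √s)) * √r.den = s * (√r.den * √r.den) * r.den * √s := by ring
      _ = s * (r.den : ℝ) ^ 2 * √s := by rw [h3]; ring
      _ ≤ c * √s := by gcongr
  set L := quadGaussSum r.den (r.num : ZMod r.den) 0 *
    (Complex.I / r.den ^ 2 * thetaRoot r.den h) with hL
  set Δ := riemannPhi (r + h) - riemannPhi r with hΔ
  have hrr : ((r : ℝ) : ℂ) = (r : ℂ) := Complex.ofReal_ratCast r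
  rw [hrr, ← hΔ] at hnear
  have hlow : √s / √r.den / 4 ≤ |(u * Δ).re| := by
    have e1 : (u * L).re = 2 * (u * Δ).re + (u * h).re - (u * (2 * Δ + h - L)).re := by
      have : u * L = ((2 : ℝ) : ℂ) * (u * Δ) + u * h - u * (2 * Δ + h - L) := by push_cast; ring
      rw [this, Complex.sub_re, Complex.add_re, Complex.re_ofReal_mul]
    have e2 : |(u * h).re| ≤ s := by
      refine (Complex.abs_re_le_norm _).trans (le_of_eq ?_)
      rw [norm_mul, hu, one_mul, Complex.norm_real, Real.norm_eq_abs, hhs]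
    have e3 : |(u * (2 * Δ + h - L)).re| ≤ C * (√r.den * (r.den * (s * √s))) := by
      refine (Complex.abs_re_le_norm _).trans ?_
      rw [norm_mul, hu, one_mul]
      exact hnear
    have e4 : |(u * L).re| ≤ 2 * |(u * Δ).re| + |(u * h).re| + |(u * (2 * Δ + h - L)).re| := by
      rw [e1]
      refine (abs_sub _ _).trans (add_le_add ((abs_add_le _ _).trans ?_) le_rfl)
      rw [abs_mul, abs_two]
    have e5 : C * (√r.den * (r.den * (s * √s))) ≤ C * (c * (√s / √r.den)) := by gcongr
    have e6 : c * (√s / √r.den) + C * (c * (√s / √r.den)) = 1 / 2 * (√s / √r.den) := by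
      rw [← hcC]; ring
    linarith
  -- Both r and r + h lie within 2d of ρ, so the assumed regularity at ρ bounds their difference.
  have hup : |(u * Δ).re| ≤ K * (2 ^ α + 1) * d ^ α := by
    have hdr : |(r : ℝ) - ρ| = d := abs_sub_comm _ _
    have hdrh : |((r : ℝ) + h) - ρ| ≤ 2 * d := by
      have : (r : ℝ) + h - ρ = ((r : ℝ) - ρ) + h := by ring
      rw [this]
      refine (abs_add_le _ _).trans ?_
      rw [hdr, hhs]; linarith
    have e1 := hK' r (by rw [hdr]; linarith)
    have e2 := hK' (r + h) (by linarith)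
    have e3 : (u * Δ).re = (u * (riemannPhi (((r : ℝ) + h : ℝ) : ℂ) - riemannPhi ρ)).re -
        (u * (riemannPhi ((r : ℝ) : ℂ) - riemannPhi ρ)).re := by
      rw [← Complex.sub_re]
      congr 1
      rw [hΔ, ← hrr]
      push_cast
      ring
    have e4 : K * |((r : ℝ) + h) - ρ| ^ α ≤ K * (2 * d) ^ α := by gcongr
    rw [Real.mul_rpow zero_le_two hd0.le] at e4
    rw [hdr] at e1
    rw [e3]
    refine (abs_sub _ _).trans ((add_le_add (e2.trans e4) e1).trans (le_of_eq ?_))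
    ring
  have hfinal : c * d ^ (1 / 2 + β) ≤ 4 * (K * (2 ^ α + 1)) * d ^ α := by
    calc c * d ^ (1 / 2 + β) = √s * d ^ β := by
          rw [Real.rpow_add hd0, ← Real.sqrt_eq_rpow, hsqrts]; ring
      _ ≤ √s * (1 / √r.den) := by gcongr
      _ = 4 * (√s / √r.den / 4) := by ring
      _ ≤ 4 * (K * (2 ^ α + 1) * d ^ α) := by linarith [hlow.trans hup]
      _ = _ := by ring
  have hpow : d ^ α = d ^ (α - 1 / 2 - β) * d ^ (1 / 2 + β) := by
    rw [← Real.rpow_add hd0]; congr 1; ring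
  rw [hpow, ← mul_assoc] at hfinal
  exact absurd (le_of_mul_le_mul_right hfinal (by positivity)) (not_le.mpr hcontra)

/-! ### Convergents and the exponent τ -/

theorem GenContFract.exists_int_contsAux_of (v : ℝ) (hv : ∀ n, ¬ (GenContFract.of v).TerminatedAt n)
    (n : ℕ) : ∃ a b : ℤ, (GenContFract.of v).contsAux n = ⟨a, b⟩ := by
  induction n using Nat.twoStepInduction with
  | zero => exact ⟨1, 0, by simp [GenContFract.contsAux]⟩
  | one => exact ⟨⌊v⌋, 1, by simp [GenContFract.contsAux, GenContFract.of_h_eq_floor]⟩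
  | more n ih1 ih2 =>
    obtain ⟨a, b, h1⟩ := ih1
    obtain ⟨a', b', h2⟩ := ih2
    obtain ⟨gp, hgp⟩ := Option.ne_none_iff_exists'.mp (hv n)
    obtain ⟨hgpa, z, hz⟩ := GenContFract.of_partNum_eq_one_and_exists_int_partDen_eq hgp
    refine ⟨z * a' + a, z * b' + b, ?_⟩
    rw [GenContFract.contsAux_recurrence hgp h1 h2, hgpa, hz]
    push_cast
    simp

namespace Irrational

variable {ρ : ℝ}

theorem not_terminatedAt_of (hρ : Irrational ρ) (n : ℕ) :
    ¬ (GenContFract.of ρ).TerminatedAt n := fun h => by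
  obtain ⟨q, hq⟩ := (GenContFract.terminates_iff_rat ρ).mp ⟨n, h⟩
  exact hρ ⟨q, hq.symm⟩

theorem exists_int_convergent (hρ : Irrational ρ) : ∃ a b : ℕ → ℤ,
    (∀ n, ((GenContFract.of ρ).nums n = a n ∧ (GenContFract.of ρ).dens n = b n)) ∧
    ∀ n, a n * b (n + 1) - b n * a (n + 1) = (-1) ^ (n + 1) := by
  choose a b hab using GenContFract.exists_int_contsAux_of ρ hρ.not_terminatedAt_of
  have h (n : ℕ) : (GenContFract.of ρ).nums n = a (n + 1) ∧
      (GenContFract.of ρ).dens n = b (n + 1) := by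
    rw [GenContFract.num_eq_conts_a, GenContFract.den_eq_conts_b,
      GenContFract.nth_cont_eq_succ_nth_contAux, hab]
    exact ⟨rfl, rfl⟩
  refine ⟨fun n => a (n + 1), fun n => b (n + 1), h, fun n => ?_⟩
  have hdet := SimpContFract.determinant (s := SimpContFract.of ρ) (hρ.not_terminatedAt_of n)
  change (GenContFract.of ρ).nums n * (GenContFract.of ρ).dens (n + 1) -
    (GenContFract.of ρ).dens n * (GenContFract.of ρ).nums (n + 1) = _ at hdet
  rw [(h n).1, (h n).2, (h (n + 1)).1, (h (n + 1)).2] at hdet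
  exact_mod_cast hdet

theorem fib_le_dens (hρ : Irrational ρ) (n : ℕ) :
    (Nat.fib (n + 1) : ℝ) ≤ (GenContFract.of ρ).dens n :=
  GenContFract.succ_nth_fib_le_of_nth_den (Or.inr (hρ.not_terminatedAt_of _))

/-- The determinant identity ±1 makes the integer continuants coprime, so the continued-fraction
denominator is already the reduced one. -/
theorem den_convergent_eq (hρ : Irrational ρ) (n : ℕ) :
    ((ρ.convergent n).den : ℝ) = (GenContFract.of ρ).dens n := by
  obtain ⟨a, b, h, hdet⟩ := hρ.exists_int_convergent
  have hb : 0 < b n := by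
    have h1 := hρ.fib_le_dens n
    rw [(h n).2] at h1
    have h2 : (0 : ℝ) < Nat.fib (n + 1) := by exact_mod_cast Nat.fib_pos.mpr (Nat.succ_pos n)
    exact_mod_cast h2.trans_le h1
  have hcop : IsCoprime (a n) (b n) := by
    refine ⟨(-1) ^ (n + 1) * b (n + 1), -((-1) ^ (n + 1) * a (n + 1)), ?_⟩
    have h1 : ((-1 : ℤ) ^ (n + 1)) * (-1) ^ (n + 1) = 1 := by rw [← mul_pow]; simp
    linear_combination (-1) ^ (n + 1) * hdet n + h1
  have hr : ρ.convergent n = (a n : ℚ) / b n := by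
    have := Real.convs_eq_convergent ρ n
    rw [GenContFract.conv_eq_num_div_den, (h n).1, (h n).2] at this
    exact_mod_cast this.symm
  have hden : ((ρ.convergent n).den : ℤ) = b n := by
    rw [hr]
    exact Rat.den_div_eq_of_coprime hb (Int.isCoprime_iff_gcd_eq_one.mp hcop)
  rw [(h n).2, ← hden]
  simp

theorem le_den_convergent (hρ : Irrational ρ) (n : ℕ) : n ≤ (ρ.convergent n).den := by
  have h1 := hρ.fib_le_dens n
  rw [← hρ.den_convergent_eq] at h1
  have h2 : Nat.fib (n + 1) ≤ (ρ.convergent n).den := by exact_mod_cast h1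
  have := Nat.le_fib_add_one (n + 1)
  omega

theorem abs_sub_convergent_le (hρ : Irrational ρ) (n : ℕ) :
    |ρ - (ρ.convergent n : ℝ)| ≤ 1 / ((ρ.convergent n).den : ℝ) ^ 2 := by
  have h := GenContFract.abs_sub_convs_le (hρ.not_terminatedAt_of n)
  rw [Real.convs_eq_convergent] at h
  have hpos : (0 : ℝ) < (ρ.convergent n).den := by exact_mod_cast (ρ.convergent n).den_pos
  refine h.trans (one_div_le_one_div_of_le (by positivity) ?_)
  rw [sq, hρ.den_convergent_eq]
  refine mul_le_mul_of_nonneg_left GenContFract.of_den_mono ?_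
  rw [← hρ.den_convergent_eq]
  exact hpos.le

theorem abs_sub_convergent_pos (hρ : Irrational ρ) (n : ℕ) :
    0 < |ρ - (ρ.convergent n : ℝ)| :=
  abs_pos.mpr (sub_ne_zero.mpr (hρ.ne_rat _))

theorem _root_.Real.tendsto_abs_sub_convergent (ρ : ℝ) :
    Tendsto (fun n => |ρ - (ρ.convergent n : ℝ)|) atTop (𝓝 0) := by
  have h := (GenContFract.of_convergence ρ)
  simp only [funext (Real.convs_eq_convergent ρ)] at h
  simpa using (h.const_sub ρ).abs

/-- By the determinant identity two consecutive denominators cannot both be even; hence the upper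
limit is along a proper filter. -/
theorem neBot_den_convergent (hρ : Irrational ρ) :
    NeBot (atTop ⊓ 𝓟 {n : ℕ | ¬ (ρ.convergent n).den ≡ 2 [MOD 4]}) := by
  rw [← frequently_mem_iff_neBot, frequently_atTop]
  intro n
  by_contra! hcon
  have h1 := hcon n le_rfl
  have h2 := hcon (n + 1) (Nat.le_succ n)
  simp only [Set.mem_ofPred_eq, not_not] at h1 h2
  obtain ⟨a, b, h, hdet⟩ := hρ.exists_int_convergent
  have hb (n : ℕ) : ((ρ.convergent n).den : ℤ) = b n := by
    have := hρ.den_convergent_eq n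
    rw [(h n).2] at this
    exact_mod_cast this
  have e1 : (2 : ℤ) ∣ b n := by
    have : (ρ.convergent n).den % 4 = 2 := h1
    rw [← hb]; omega
  have e2 : (2 : ℤ) ∣ b (n + 1) := by
    have : (ρ.convergent (n + 1)).den % 4 = 2 := h2
    rw [← hb]; omega
  have e3 : (2 : ℤ) ∣ (-1) ^ (n + 1) := by
    rw [← hdet n]
    exact dvd_sub (e2.mul_left _) (e1.mul_right _)
  have e4 := isUnit_of_dvd_unit e3 ((isUnit_one.neg).pow (n + 1))
  rw [Int.isUnit_iff] at e4
  omega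

theorem two_le_convergentExponent (hρ : Irrational ρ) {n : ℕ} (hn : 2 ≤ n) :
    2 ≤ convergentExponent ρ n := by
  have hq := hn.trans (hρ.le_den_convergent n)
  have hq2 : (2 : ℝ) ≤ (ρ.convergent n).den := by exact_mod_cast hq
  have h := hρ.abs_sub_convergent_le n
  rw [abs_sub_convergent_eq hρ (by omega)] at h
  have h2 : 1 / ((ρ.convergent n).den : ℝ) ^ 2 = (1 / ((ρ.convergent n).den : ℝ)) ^ (2 : ℝ) := by
    rw [Real.rpow_two, div_pow, one_pow]
  rw [h2] at h
  exact (Real.rpow_le_rpow_left_iff_of_base_lt_one (by positivity)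
    (by rw [div_lt_one (by linarith)]; linarith)).mp h

theorem two_le_convergentTau (hρ : Irrational ρ) : 2 ≤ convergentTau ρ := by
  have := hρ.neBot_den_convergent
  refine le_limsup_of_frequently_le (Eventually.frequently ?_)
  refine mem_inf_of_left ?_
  filter_upwards [eventually_ge_atTop 2] with n hn
  exact EReal.coe_le_coe_iff.mpr (hρ.two_le_convergentExponent hn)

/-- By Legendre, a fraction closer than 1/(2q²) is a convergent, and late ones satisfy τₙ < τ. For
all other fractions the trivial exponent 2 ≤ τ suffices. -/
theorem exists_forall_rat_le_of_convergentTau_lt (hρ : Irrational ρ) {τ : ℝ} (h2 : 2 ≤ τ)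
    (hτ : convergentTau ρ < τ) : ∃ C : ℝ, 0 ≤ C ∧
      ∀ r : ℚ, ¬ r.den ≡ 2 [MOD 4] → 1 / √r.den ≤ C * |ρ - r| ^ (1 / (2 * τ)) := by
  have hτ0 : 0 < τ := by linarith
  have hev := eventually_lt_of_limsup_lt hτ
  rw [eventually_inf_principal, eventually_atTop] at hev
  obtain ⟨N, hN⟩ := hev
  set β := 1 / (2 * τ) with hβ
  have hβ0 : 0 ≤ β := by positivity
  have hβ4 : β ≤ 1 / 4 := by
    rw [hβ]
    exact one_div_le_one_div_of_le (by norm_num) (by linarith)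
  -- Covers the finitely many early convergents, including those with n < 2 where qₙ = 1 is
  -- possible.
  set C₁ := ∑ n ∈ Finset.range (max N 2), (|ρ - (ρ.convergent n : ℝ)| ^ β)⁻¹ with hC₁
  have hC₁0 : 0 ≤ C₁ := Finset.sum_nonneg fun n _ => by positivity
  refine ⟨2 + C₁, by positivity, fun r hr => ?_⟩
  have hq1 : (1 : ℝ) ≤ r.den := by exact_mod_cast r.den_pos
  have hd0 : 0 < |ρ - r| := abs_pos.mpr (sub_ne_zero.mpr (hρ.ne_rat r))
  have hle {c : ℝ} (hc : c ≤ 2 + C₁) (h : 1 / √r.den ≤ c * |ρ - r| ^ β) :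
      1 / √r.den ≤ (2 + C₁) * |ρ - r| ^ β :=
    h.trans (mul_le_mul_of_nonneg_right hc (by positivity))
  rcases lt_or_ge |ρ - r| (1 / (2 * (r.den : ℝ) ^ 2)) with hlt | hge
  · obtain ⟨n, rfl⟩ := Real.exists_rat_eq_convergent hlt
    rcases lt_or_ge n (max N 2) with hn | hn
    · refine hle (c := (|ρ - (ρ.convergent n : ℝ)| ^ β)⁻¹) ?_ ?_
      · have : (|ρ - (ρ.convergent n : ℝ)| ^ β)⁻¹ ≤ C₁ :=
          Finset.single_le_sum (f := fun n => (|ρ - (ρ.convergent n : ℝ)| ^ β)⁻¹)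
            (fun n _ => by positivity) (Finset.mem_range.mpr hn)
        linarith
      · rw [inv_mul_cancel₀ (by positivity)]
        exact div_le_one_of_le₀ (Real.one_le_sqrt.mpr hq1) (by positivity)
    · refine hle (c := 1) (by linarith) ?_
      have hn2 : 2 ≤ n := (le_max_right _ _).trans hn
      have hq := hn2.trans (hρ.le_den_convergent n)
      have hlt := hN n ((le_max_left _ _).trans hn) hr
      rw [EReal.coe_lt_coe_iff] at hlt
      rw [one_mul, abs_sub_convergent_eq hρ (by omega), ← Real.rpow_mul (by positivity)]
      have h3 : 1 / √((ρ.convergent n).den : ℝ) =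
          (1 / ((ρ.convergent n).den : ℝ)) ^ (1 / 2 : ℝ) := by
        rw [← Real.sqrt_eq_rpow, Real.sqrt_div zero_le_one, Real.sqrt_one]
      rw [h3]
      refine Real.rpow_le_rpow_of_exponent_ge (by positivity)
        (div_le_one_of_le₀ hq1 (by positivity)) ?_
      calc convergentExponent ρ n * β ≤ τ * β := by gcongr
        _ = 1 / 2 := by rw [hβ]; field_simp
  · refine hle (c := 2) (by linarith) ?_
    have h3 : 1 / √(r.den : ℝ) = (2 : ℝ) ^ (1 / 4 : ℝ) *
        (1 / (2 * (r.den : ℝ) ^ 2)) ^ (1 / 4 : ℝ) := by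
      rw [← Real.mul_rpow zero_le_two (by positivity)]
      have : 2 * (1 / (2 * (r.den : ℝ) ^ 2)) = (1 / √(r.den : ℝ)) ^ 4 := by
        rw [div_pow, one_pow, show √(r.den : ℝ) ^ 4 = (√(r.den : ℝ) ^ 2) ^ 2 by ring,
          Real.sq_sqrt (by linarith)]
        field_simp
      rw [this, ← Real.rpow_natCast, ← Real.rpow_mul (by positivity)]
      norm_num
    have h4 : (2 : ℝ) ^ (1 / 4 : ℝ) ≤ 2 := by
      calc (2 : ℝ) ^ (1 / 4 : ℝ) ≤ 2 ^ (1 : ℝ) :=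
            Real.rpow_le_rpow_of_exponent_le one_le_two (by norm_num)
        _ = 2 := Real.rpow_one 2
    have h5 : (1 / (2 * (r.den : ℝ) ^ 2)) ^ (1 / 4 : ℝ) ≤ |ρ - r| ^ β := by
      calc (1 / (2 * (r.den : ℝ) ^ 2)) ^ (1 / 4 : ℝ) ≤ (1 / (2 * (r.den : ℝ) ^ 2)) ^ β := by
            refine Real.rpow_le_rpow_of_exponent_ge (by positivity) ?_ hβ4
            rw [div_le_one (by positivity)]
            nlinarith
        _ ≤ |ρ - r| ^ β := by gcongr
    rw [h3]
    exact mul_le_mul h4 h5 (by positivity) zero_le_two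

theorem exists_rat_of_lt_convergentTau (hρ : Irrational ρ) {τ : ℝ} (h0 : 0 < τ)
    (hτ : (τ : EReal) < convergentTau ρ) : ∀ δ > 0, ∃ r : ℚ, ¬ r.den ≡ 2 [MOD 4] ∧
      0 < |ρ - r| ∧ |ρ - r| < δ ∧ |ρ - r| ≤ 1 / (r.den : ℝ) ^ 2 ∧
      |ρ - r| ^ (1 / (2 * τ)) ≤ 1 / √r.den := by
  intro δ hδ
  have hfr := frequently_lt_of_lt_limsup (by isBoundedDefault) hτ
  rw [frequently_inf_principal] at hfr
  obtain ⟨n, ⟨hnS, hnτ⟩, hnδ, hn2⟩ := (hfr.and_eventually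
    (((Real.tendsto_abs_sub_convergent ρ).eventually_lt_const hδ).and (eventually_ge_atTop 2))).exists
  have hq := hn2.trans (hρ.le_den_convergent n)
  have hq1 : (1 : ℝ) ≤ (ρ.convergent n).den := by exact_mod_cast (ρ.convergent n).den_pos
  rw [EReal.coe_lt_coe_iff] at hnτ
  refine ⟨ρ.convergent n, hnS, hρ.abs_sub_convergent_pos n, hnδ, hρ.abs_sub_convergent_le n, ?_⟩
  have h3 : 1 / √((ρ.convergent n).den : ℝ) =
      (1 / ((ρ.convergent n).den : ℝ)) ^ (1 / 2 : ℝ) := by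
    rw [← Real.sqrt_eq_rpow, Real.sqrt_div zero_le_one, Real.sqrt_one]
  rw [h3, abs_sub_convergent_eq hρ (by omega), ← Real.rpow_mul (by positivity)]
  refine Real.rpow_le_rpow_of_exponent_ge (by positivity)
    (div_le_one_of_le₀ hq1 (by positivity)) ?_
  calc (1 / 2 : ℝ) = τ * (1 / (2 * τ)) := by field_simp
    _ ≤ convergentExponent ρ n * (1 / (2 * τ)) := by gcongr

end Irrational

/-! ### Evaluation of the exponent -/

theorem one_div_two_add_one_div_two_mul_coe (t : ℝ) :
    (1 / 2 + 1 / (2 * (t : EReal)) : EReal) = ((1 / 2 + 1 / (2 * t) : ℝ) : EReal) := by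
  norm_cast

theorem tendsto_one_half_add_one_div {t : ℝ} (ht : 0 < t) :
    Tendsto (fun s : ℝ => ((1 / 2 + 1 / (2 * s) : ℝ) : EReal)) (𝓝 t)
      (𝓝 ((1 / 2 + 1 / (2 * t) : ℝ) : EReal)) := by
  refine (continuous_coe_real_ereal.tendsto _).comp ?_
  have : ContinuousAt (fun s : ℝ => 1 / 2 + 1 / (2 * s)) t := by
    refine continuousAt_const.add (continuousAt_const.div (by fun_prop) (by positivity))
  exact this

/-- The Hölder exponent of any function that is at least as regular as `φ` at `ρ` and controls
one real component of `φ` there. -/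
theorem pointwiseHolderExponent_eq {ρ : ℝ} (hρ : Irrational ρ) {E : Type*} [NormedAddCommGroup E]
    {f : ℝ → E}
    (hle : (fun h : ℝ => f (ρ + h) - f ρ) =O[𝓝 0]
      fun h : ℝ => riemannPhi ((ρ + h : ℝ) : ℂ) - riemannPhi ρ)
    {u : ℂ} (hu : ‖u‖ = 1)
    (hge : (fun h : ℝ => (u * (riemannPhi ((ρ + h : ℝ) : ℂ) - riemannPhi ρ)).re) =O[𝓝 0]
      fun h : ℝ => f (ρ + h) - f ρ) :
    pointwiseHolderExponent f ρ = 1 / 2 + 1 / (2 * convergentTau ρ) := by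
  have hlow {β C : ℝ} (hβ0 : 0 ≤ β) (hβ : β ≤ 1 / 4) (hC0 : 0 ≤ C)
      (hC : ∀ r : ℚ, ¬ r.den ≡ 2 [MOD 4] → 1 / √r.den ≤ C * |ρ - r| ^ β) :
      ((1 / 2 + β : ℝ) : EReal) ≤ pointwiseHolderExponent f ρ :=
    le_iSup₂_of_le (1 / 2 + β)
      ⟨by positivity, hle.trans (riemannPhi_sub_isBigO_of_forall_rat hβ0 hβ hC0 hC)⟩ le_rfl
  have hup {s : ℝ} (hs : 0 < s) (hsτ : (s : EReal) < convergentTau ρ) :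
      pointwiseHolderExponent f ρ ≤ ((1 / 2 + 1 / (2 * s) : ℝ) : EReal) := by
    refine iSup₂_le fun α hα => EReal.coe_le_coe_iff.mpr ?_
    by_contra! hlt
    exact not_isBigO_of_frequently_rat (by positivity) hlt
      (hρ.exists_rat_of_lt_convergentTau hs hsτ) hu (hge.trans hα.2)
  have h2 := hρ.two_le_convergentTau
  induction hτ : convergentTau ρ using EReal.rec with
  | bot => rw [hτ] at h2; exact absurd h2 (by decide)
  | top =>
    have htop : (1 / 2 + 1 / (2 * ⊤) : EReal) = ((1 / 2 : ℝ) : EReal) := by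
      rw [EReal.mul_top_of_pos (by norm_num), EReal.div_top, add_zero]
      norm_cast
    rw [htop]
    refine le_antisymm ?_ ?_
    · have hlim : Tendsto (fun s : ℝ => ((1 / 2 + 1 / (2 * s) : ℝ) : EReal)) atTop
          (𝓝 ((1 / 2 : ℝ) : EReal)) := by
        refine (continuous_coe_real_ereal.tendsto _).comp ?_
        have : Tendsto (fun s : ℝ => 1 / (2 * s)) atTop (𝓝 0) :=
          tendsto_const_nhds.div_atTop (tendsto_id.const_mul_atTop two_pos)
        have h := this.const_add (1 / 2)
        rwa [add_zero] at h
      refine ge_of_tendsto hlim ?_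
      filter_upwards [eventually_gt_atTop 0] with s hs
      exact hup hs (by rw [hτ]; exact EReal.coe_lt_top s)
    -- With β = 0 the Diophantine hypothesis is just 1/√q ≤ 1.
    · have := hlow (β := 0) (C := 1) le_rfl (by norm_num) zero_le_one fun r _ => by
        rw [Real.rpow_zero, mul_one]
        exact div_le_one_of_le₀ (Real.one_le_sqrt.mpr (by exact_mod_cast r.den_pos))
          (by positivity)
      simpa using this
  | coe t =>
    rw [hτ] at h2
    have ht : 2 ≤ t := EReal.coe_le_coe_iff.mp h2
    have ht0 : 0 < t := by linarith
    rw [one_div_two_add_one_div_two_mul_coe t]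
    refine le_antisymm ?_ ?_
    -- The two bounds hold for s < t and s > t respectively; continuity of s ↦ 1/2 + 1/(2s) closes
    -- the gap.
    · refine ge_of_tendsto (x := 𝓝[<] t)
        ((tendsto_one_half_add_one_div ht0).mono_left nhdsWithin_le_nhds) ?_
      filter_upwards [Ioo_mem_nhdsLT ht0] with s hs
      exact hup hs.1 (by rw [hτ]; exact EReal.coe_lt_coe_iff.mpr hs.2)
    · refine le_of_tendsto (x := 𝓝[>] t)
        ((tendsto_one_half_add_one_div ht0).mono_left nhdsWithin_le_nhds) ?_
      filter_upwards [self_mem_nhdsWithin] with s hs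
      have hts : t < s := hs
      obtain ⟨C, hC0, hC⟩ := hρ.exists_forall_rat_le_of_convergentTau_lt (τ := s) (by linarith)
        (by rw [hτ]; exact EReal.coe_lt_coe_iff.mpr hts)
      have hs0 : 0 < s := by linarith
      exact hlow (by positivity)
        (one_div_le_one_div_of_le (by norm_num) (by linarith)) hC0 hC

theorem mainTheorem1 (ρ : ℝ) (hρ : Irrational ρ) :
    pointwiseHolderExponent (fun x : ℝ => riemannPhi (x : ℂ)) ρ
        = 1 / 2 + 1 / (2 * convergentTau ρ) ∧
      pointwiseHolderExponent (fun x : ℝ => (riemannPhi (x : ℂ)).re) ρ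
        = 1 / 2 + 1 / (2 * convergentTau ρ) ∧
      pointwiseHolderExponent (fun x : ℝ => (riemannPhi (x : ℂ)).im) ρ
        = 1 / 2 + 1 / (2 * convergentTau ρ) := by
  -- The direction u = -i turns the real part into the imaginary part.
  refine ⟨pointwiseHolderExponent_eq hρ (isBigO_refl _ _) (u := 1) norm_one ?_,
    pointwiseHolderExponent_eq hρ ?_ (u := 1) norm_one ?_,
    pointwiseHolderExponent_eq hρ ?_ (u := -Complex.I) (by simp) ?_⟩
  · refine IsBigO.of_bound' (Eventually.of_forall fun h => ?_)
    rw [one_mul]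
    exact Complex.abs_re_le_norm _
  · refine IsBigO.of_bound' (Eventually.of_forall fun h => ?_)
    rw [← Complex.sub_re]
    exact Complex.abs_re_le_norm _
  · refine IsBigO.of_bound' (Eventually.of_forall fun h => ?_)
    rw [one_mul, Complex.sub_re]
  · refine IsBigO.of_bound' (Eventually.of_forall fun h => ?_)
    rw [← Complex.sub_im]
    exact Complex.abs_im_le_norm _
  · refine IsBigO.of_bound' (Eventually.of_forall fun h => ?_)
    rw [neg_mul, Complex.neg_re, Complex.I_mul_re, neg_neg, Complex.sub_im]
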